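/- Let $d\ge 1$. For a Borel probability measure $\mu$ on $\mathbb R^d$ let $\mathcal M_p(\mu)=\int|x|^p\,d\mu\in[0,\infty]$, let $R(\mu)=\inf\{r>0:\operatorname{supp}\mu\subset\{|x|\le r\}\}\in[0,\infty]$ (with $\inf\emptyset=\infty$), and for $\vartheta\in\mathbb S^{d-1}$ let $\mu^\vartheta$ be the push-forward of $\mu$ under $x\mapsto x\cdot\vartheta$. Let $\mathscr P_q(\mathbb R^d)$ be the set of probability measures with $\mathcal M_q<\infty$, let $W_q$ be the $q$-Wasserstein distance, and let $\sigma$ be the surface measure on $\mathbb S^{d-1}$, normalized to total mass $1$. For one-dimensional probability measures $\alpha,\beta$ with cumulative distribution functions $F_\alpha,F_\beta$, the nondecreasing map from $\alpha$ to $\beta$ is $T(y)=\inf\{s:F_\beta(s)\ge F_\alpha(y)\}$. Let $\nu\in\mathscr P_2(\mathbb R^d)$ and let $(\rho_t)_{t\ge0}$ be a sliced-Wasserstein flow (SWF) with target $\nu$, that is, a curve in $\mathscr P_2(\mathbb R^d)$, locally absolutely continuous with respect to $W_2$, such that for a.e. $t$ the projections $\rho_t^\vartheta$ are atomless for $\sigma$-a.e.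 $\vartheta$ (which is automatic if $\rho_t$ is absolutely continuous with respect to the Lebesgue measure), and which solves in the weak sense, with test functions in $C_c^\infty(\mathbb R^d)$, the continuity equation $$\partial_t\rho_t+\nabla\cdot(\rho_t v_t)=0,\qquad v_t(x)=\int_{\mathbb S^{d-1}}\big(T_t^\vartheta(x\cdot\vartheta)-x\cdot\vartheta\big)\,\vartheta\,d\sigma(\vartheta),$$ where $T_t^\vartheta$ is the nondecreasing map from $\rho_t^\vartheta$ to $\nu^\vartheta$. For $p\ge2$ put $c_{p,d}=\int_{\mathbb S^{d-1}}|e\cdot\vartheta|^p\,d\sigma(\vartheta)$, where $e$ is the first vector of the standard basis. Then: 1. For every $p\ge 2$, $\int_{\mathbb S^{d-1}}|x\cdot\vartheta|^p\,d\sigma(\vartheta)=c_{p,d}|x|^p$ for all $x\in\mathbb R^d$, and $$\mathcal M_p(\rho_t)\le\max\{\mathcal M_p(\rho_0),\,d^{p/2}c_{p,d}\,\mathcal M_p(\nu)\}\qquad\text{for all }t\ge0 .$$ 2. $R(\rho_t)\le\max\{R(\rho_0),\sqrt d\,R(\nu)\}$ for all $t\ge0$. 3. If $p\ge2$, $\mathcal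 M_p(\rho_0)<\infty$ and $\mathcal M_p(\nu)<\infty$, then for every $q$ with $1\le q<p$ the flow is a compact curve in $W_q$: the curve $[0,\infty)\ni t\mapsto\rho_t$ takes values in $\mathscr P_q(\mathbb R^d)$ and is continuous with respect to $W_q$, and its range $\{\rho_t:t\ge0\}$ is relatively compact in $(\mathscr P_q(\mathbb R^d),W_q)$, i.e. every sequence in it has a subsequence converging in $W_q$ to an element of $\mathscr P_q(\mathbb R^d)$. -/

import Mathlib

open MeasureTheory Set Filter Topology
open scoped ENNReal ContDiff

noncomputable section

namespace SWF

/-- The Euclidean space `ℝ^d`. -/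
abbrev E (d : ℕ) : Type := EuclideanSpace ℝ (Fin d)

/-- The unit sphere of `ℝ^d`. -/
abbrev S (d : ℕ) : Type := Metric.sphere (0 : E d) 1

/-- The surface measure on the unit sphere. It is not normalized; it is only used in averages
and in almost-everywhere statements. -/
def surf (d : ℕ) : Measure (S d) := (volume : Measure (E d)).toSphere

/-- The moment `∫ |x|^p dμ`, with values in `[0, ∞]`. -/
def moment {d : ℕ} (p : ℝ) (μ : Measure (E d)) : ℝ≥0∞ := ∫⁻ x, ‖x‖ₑ ^ p ∂μ

/-- The constant `c_{p,d} = ⨍ |e · ϑ|^p`, where `e` is the first vector of the standard basis. -/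
def sphereConst (d : ℕ) [NeZero d] (p : ℝ) : ℝ :=
  ⨍ θ : S d, |inner ℝ (EuclideanSpace.single (0 : Fin d) (1 : ℝ)) (θ : E d)| ^ p ∂(surf d)

/-- The support radius `inf {r > 0 : supp μ ⊆ {|x| ≤ r}}`, equal to `∞` when the support
is unbounded. -/
def supportRadius {d : ℕ} (μ : Measure (E d)) : ℝ≥0∞ :=
  ⨅ (r : ℝ) (_ : 0 < r) (_ : μ.support ⊆ Metric.closedBall (0 : E d) r), ENNReal.ofReal r

/-- The `p`-Wasserstein distance, with values in `[0, ∞]`, defined through transport plans. -/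
def wasserstein {d : ℕ} (p : ℝ) (μ ν : Measure (E d)) : ℝ≥0∞ :=
  (⨅ (γ : Measure (E d × E d)) (_ : γ.fst = μ ∧ γ.snd = ν),
    ∫⁻ z, edist z.1 z.2 ^ p ∂γ) ^ (1 / p)

/-- The projection `π^ϑ_# μ` of a measure on the line directed by `ϑ`. -/
def proj {d : ℕ} (μ : Measure (E d)) (θ : S d) : Measure ℝ :=
  μ.map (fun x => inner ℝ x (θ : E d))

/-- The nondecreasing rearrangement `F_ν^{[-1]} ∘ F_μ`, where `F_μ(x) = μ((-∞, x])` and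
`F^{[-1]}(y) = inf {t : F(t) ≥ y}`. When `μ` and `ν` are probability measures and `μ` is
atomless, this is the optimal transport map from `μ` to `ν`. -/
def monotoneMap (μ ν : Measure ℝ) (x : ℝ) : ℝ :=
  sInf {t : ℝ | μ.real (Iic x) ≤ ν.real (Iic t)}

/-- The velocity field `v[ρ, ν](x) = ⨍ (T^ϑ(x · ϑ) - x · ϑ) ϑ dϑ`. -/
def velocity {d : ℕ} (ρ ν : Measure (E d)) (x : E d) : E d :=
  ⨍ θ : S d, (monotoneMap (proj ρ θ) (proj ν θ) (inner ℝ x (θ : E d))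
    - inner ℝ x (θ : E d)) • (θ : E d) ∂(surf d)

/-- `(ρ_t)_{t ≥ 0}` is a locally absolutely continuous curve for `W_2`. -/
def IsACCurve {d : ℕ} (ρ : ℝ → Measure (E d)) : Prop :=
  ∃ g : ℝ → ℝ, (∀ r, 0 ≤ g r) ∧ (∀ T : ℝ, IntegrableOn g (Icc 0 T)) ∧
    ∀ s t : ℝ, 0 ≤ s → s ≤ t →
      wasserstein 2 (ρ s) (ρ t) ≤ ENNReal.ofReal (∫ r in s..t, g r)

/-- `∂_t ρ + ∇ · (ρ v) = 0` on `[0, ∞) × ℝ^d`, in the weak sense: for every test function `φ`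
the function `t ↦ ∫ φ dρ_t` is absolutely continuous, with derivative `∫ ∇φ · v_t dρ_t`. -/
def SolvesContinuityEq {d : ℕ} (ρ : ℝ → Measure (E d)) (v : ℝ → E d → E d) : Prop :=
  ∀ φ : E d → ℝ, ContDiff ℝ ∞ φ → HasCompactSupport φ → ∀ s t : ℝ, 0 ≤ s → s ≤ t →
    IntervalIntegrable (fun r => ∫ x, inner ℝ (gradient φ x) (v r x) ∂(ρ r)) volume s t ∧
    ∫ x, φ x ∂(ρ t) - ∫ x, φ x ∂(ρ s)
      = ∫ r in s..t, ∫ x, inner ℝ (gradient φ x) (v r x) ∂(ρ r)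

/-- `(ρ_t)_{t ≥ 0}` is a sliced-Wasserstein flow with target `ν`: a curve of probability measures
with finite second moment, absolutely continuous for `W_2`, that solves the continuity equation
with velocity `v[ρ_t, ν]`. The condition `noAtoms` makes the maps `T^ϑ` transport maps; it holds
whenever `ρ_t` is absolutely continuous with respect to the Lebesgue measure.
Only times `t ≥ 0` matter. -/
structure IsSlicedWassersteinFlow {d : ℕ} (ν : Measure (E d)) (ρ : ℝ → Measure (E d)) : Prop where
  isProb_target : IsProbabilityMeasure ν
  moment_target : moment 2 ν < ⊤
  isProb : ∀ t, 0 ≤ t → IsProbabilityMeasure (ρ t)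
  moment_two : ∀ t, 0 ≤ t → moment 2 (ρ t) < ⊤
  noAtoms : ∀ᵐ t ∂(volume.restrict (Ici (0 : ℝ))), ∀ᵐ θ ∂(surf d), NullSingletonClass (proj (ρ t) θ)
  acCurve : IsACCurve ρ
  continuityEq : SolvesContinuityEq ρ (fun t => velocity (ρ t) ν)

/-- `A` is a relatively (sequentially) compact subset of the Wasserstein space
`(𝒫_q(ℝ^d), W_q)`. -/
def IsRelCompactWasserstein {d : ℕ} (q : ℝ) (A : Set (Measure (E d))) : Prop :=
  (∀ μ ∈ A, IsProbabilityMeasure μ ∧ moment q μ < ⊤) ∧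
  ∀ u : ℕ → Measure (E d), (∀ n, u n ∈ A) →
    ∃ μ : Measure (E d), IsProbabilityMeasure μ ∧ moment q μ < ⊤ ∧
      ∃ k : ℕ → ℕ, StrictMono k ∧
        Tendsto (fun n => wasserstein q (u (k n)) μ) atTop (𝓝 0)

end SWF

end

open MeasureTheory Set Filter Topology
open scoped ENNReal ContDiff

noncomputable section

namespace SWF

/-! Let `G = prim g` be convex and nondecreasing on `[0, ∞)` with `G 0 = 0`, and put `m(t) = ∫
G(|x|²) dρ_t`. Along the flow `m' = ∫⨍ 2 g(|x|²) (T - a) a` with `a = x · ϑ` and `T = T^ϑ(a)`. Two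
convexity inequalities close this expression. First, `2 (T - a) a ≤ T² - a²`, and `a²` averages to
`|x|²/d` over the sphere. Second, the tangent of `G` at `|x|²` gives `g(|x|²) (d T² - |x|²) ≤ G(d
T²) - G(|x|²)`. Since `T^ϑ` pushes `ρ_t^ϑ` to `ν^ϑ`, the integral of `G(d T²)` equals `E = ∫⨍ G(d (y
· ϑ)²) dσ dν`, independent of `t`. Hence `m' ≤ (E - m)/d`, and `m(t) ≤ max (m(0), E)`
(`inner_velocity_le`, `integral_inner_velocity_le`, `integral_prim_le`).

With `G(s) = s^(p/2)`, `E` is `d^(p/2) c_{p,d}` times the `p`-th moment of `ν`; with `G` vanishing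
exactly on `[0, R²]`, `E = 0` as soon as `√d |y| ≤ R` on the support of `ν`. The profiles `g` are
smooth and bounded, so that `G(|x|²)` is controlled by second moments and is a limit of test
functions (`exists_testFunction`, `prim_integral_formula`); powers are reached by Fatou's lemma
(`moment_le`).

For the last claim, `p`-th moments are now uniformly bounded. Such a bound upgrades couplings that
concentrate near the diagonal to `W_q` convergence for `q < p` (`tendsto_wasserstein`). The
couplings come from `W_2` continuity for the curve, and from Prokhorov's theorem with a partition of
unity for compactness. -/

/-! ### Monotone transport on the line. -/

/-- Measurable dependence of a generalized inverse on a parameter. -/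
theorem measurable_sInf_setOf_le {Ω : Type*} [MeasurableSpace Ω] {a : Ω → ℝ} {F : Ω → ℝ → ℝ}
    (ha : Measurable a) (hF : ∀ t, Measurable fun z => F z t) (hmono : ∀ z, Monotone (F z))
    (hnonneg : ∀ z t, 0 ≤ F z t) (hlim : ∀ z, Tendsto (F z) atBot (𝓝 0)) :
    Measurable fun z => sInf {t : ℝ | a z ≤ F z t} := by
  refine measurable_of_Iio fun c => ?_
  -- If `a z ≤ 0` the set is all of `ℝ`, and it may also be empty; in both cases `sInf` takes the
  -- default value `0`, hence the conditions `0 < c`. Otherwise monotonicity in `t` allows rational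
  -- witnesses.
  have key : (fun z => sInf {t : ℝ | a z ≤ F z t}) ⁻¹' Iio c =
      ({z | a z ≤ 0} ∩ {_z | 0 < c}) ∪
      ({z | 0 < a z} ∩ ((⋃ q : ℚ, {z | a z ≤ F z q} ∩ {_z | (q : ℝ) < c}) ∪
        ((⋃ q : ℚ, {z | a z ≤ F z q})ᶜ ∩ {_z | 0 < c}))) := by
    ext z
    simp only [mem_preimage, mem_Iio, mem_union, mem_inter_iff, mem_ofPred_eq, mem_iUnion,
      mem_compl_iff, not_exists]
    rcases le_or_gt (a z) 0 with h0 | h0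
    · have : {t : ℝ | a z ≤ F z t} = univ := by
        ext t; simpa using h0.trans (hnonneg z t)
      simp [this, h0, not_lt.2 h0]
    · have hb : BddBelow {t : ℝ | a z ≤ F z t} := by
        obtain ⟨b, hb⟩ := ((hlim z).eventually (gt_mem_nhds h0)).exists
        exact ⟨b, fun t ht => le_of_not_gt fun htb => (ht.trans (hmono z htb.le)).not_gt hb⟩
      simp only [not_le.2 h0, h0, true_and, false_and, false_or]
      by_cases hne : {t : ℝ | a z ≤ F z t}.Nonempty
      · have hq : ∃ q : ℚ, a z ≤ F z q := by
          obtain ⟨t, ht⟩ := hne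
          obtain ⟨q, hq⟩ := exists_rat_gt t
          exact ⟨q, le_trans ht (hmono z hq.le)⟩
        rw [csInf_lt_iff hb hne]
        constructor
        · rintro ⟨t, ht, htc⟩
          obtain ⟨q, hq1, hq2⟩ := exists_rat_btwn htc
          exact Or.inl ⟨q, le_trans ht (hmono z hq1.le), hq2⟩
        · rintro (⟨q, hq1, hq2⟩ | ⟨h, _⟩)
          · exact ⟨q, hq1, hq2⟩
          · exact absurd hq.choose_spec (h _)
      · have hq : ∀ q : ℚ, ¬ a z ≤ F z q := fun q hq => hne ⟨q, hq⟩
        rw [not_nonempty_iff_eq_empty.1 hne]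
        simp [hq]
  rw [key]
  have h1 : ∀ q : ℚ, MeasurableSet {z | a z ≤ F z q} := fun q => measurableSet_le ha (hF q)
  have h2 : MeasurableSet {z | a z ≤ 0} := measurableSet_le ha measurable_const
  have h3 : MeasurableSet {z | 0 < a z} := measurableSet_lt measurable_const ha
  exact (h2.inter (.const _)).union (h3.inter ((MeasurableSet.iUnion fun q =>
    (h1 q).inter (.const _)).union ((MeasurableSet.iUnion h1).compl.inter (.const _))))

theorem monotone_real_Iic (μ : Measure ℝ) [IsFiniteMeasure μ] :
    Monotone fun x => μ.real (Iic x) :=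
  fun _ _ h => measureReal_mono (Iic_subset_Iic.2 h)

theorem real_Iic_eq_cdf (μ : Measure ℝ) [IsProbabilityMeasure μ] :
    (fun x => μ.real (Iic x)) = ProbabilityTheory.cdf μ :=
  funext fun x => (ProbabilityTheory.cdf_eq_real μ x).symm

theorem tendsto_real_Iic_atBot (μ : Measure ℝ) [IsProbabilityMeasure μ] :
    Tendsto (fun x => μ.real (Iic x)) atBot (𝓝 0) := by
  rw [real_Iic_eq_cdf]; exact ProbabilityTheory.tendsto_cdf_atBot μ

theorem tendsto_real_Iic_atTop (μ : Measure ℝ) [IsProbabilityMeasure μ] :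
    Tendsto (fun x => μ.real (Iic x)) atTop (𝓝 1) := by
  rw [real_Iic_eq_cdf]; exact ProbabilityTheory.tendsto_cdf_atTop μ

theorem continuousWithinAt_real_Iic (μ : Measure ℝ) [IsProbabilityMeasure μ] (x : ℝ) :
    ContinuousWithinAt (fun x => μ.real (Iic x)) (Ici x) x := by
  rw [real_Iic_eq_cdf]; exact (ProbabilityTheory.cdf μ).right_continuous x

theorem continuous_real_Iic (μ : Measure ℝ) [IsProbabilityMeasure μ] [NullSingletonClass μ] :
    Continuous fun x => μ.real (Iic x) := by
  have h : ∀ x, ContinuousAt (ProbabilityTheory.cdf μ) x := fun x => by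
    rw [(ProbabilityTheory.cdf μ).mono.continuousAt_iff_leftLim_eq_rightLim,
      (ProbabilityTheory.cdf μ).rightLim_eq]
    have h1 : (ProbabilityTheory.cdf μ).measure {x} = 0 := by
      rw [ProbabilityTheory.measure_cdf]; exact measure_singleton x
    rw [StieltjesFunction.measure_singleton, ENNReal.ofReal_eq_zero] at h1
    have h2 := (ProbabilityTheory.cdf μ).mono.leftLim_le (le_refl x)
    linarith
  rw [real_Iic_eq_cdf]; exact continuous_iff_continuousAt.2 h

/-- The Galois property of the quantile function: right continuity of the distribution function puts
the infimum in the set. The two hypotheses make the set bounded below and nonempty, so that `sInf`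
is a true infimum. -/
theorem monotoneMap_le_iff {α β : Measure ℝ} [IsProbabilityMeasure β]
    {x : ℝ} (h0 : 0 < α.real (Iic x)) (h1 : ∃ s, α.real (Iic x) ≤ β.real (Iic s)) (s : ℝ) :
    monotoneMap α β x ≤ s ↔ α.real (Iic x) ≤ β.real (Iic s) := by
  have hb : BddBelow {t : ℝ | α.real (Iic x) ≤ β.real (Iic t)} := by
    obtain ⟨b, hb⟩ := ((tendsto_real_Iic_atBot β).eventually (gt_mem_nhds h0)).exists
    exact ⟨b, fun t ht => le_of_not_gt fun htb =>
      (ht.trans (monotone_real_Iic β htb.le)).not_gt hb⟩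
  refine ⟨fun h => ?_, fun h => csInf_le hb h⟩
  have hlim : Tendsto (fun x => β.real (Iic x)) (𝓝[>] s) (𝓝 (β.real (Iic s))) :=
    (continuousWithinAt_real_Iic β s).mono Ioi_subset_Ici_self
  refine ge_of_tendsto hlim ?_
  filter_upwards [self_mem_nhdsWithin] with t ht
  obtain ⟨t', ht', htt⟩ := (csInf_lt_iff hb h1).1 (lt_of_le_of_lt h ht)
  exact le_trans ht' (monotone_real_Iic β htt.le)

/-- The distribution function of an atomless probability measure is uniformly distributed. -/
theorem measure_setOf_real_Iic_le (μ : Measure ℝ) [IsProbabilityMeasure μ] [NullSingletonClass μ]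
    {u : ℝ} (h0 : 0 ≤ u) (h1 : u ≤ 1) : μ {y | μ.real (Iic y) ≤ u} = ENNReal.ofReal u := by
  rcases h1.eq_or_lt with rfl | h1
  · have : {y | μ.real (Iic y) ≤ 1} = univ :=
      eq_univ_of_forall fun y => measureReal_le_one
    rw [this]; simp
  have hb : BddAbove {y | μ.real (Iic y) ≤ u} := by
    obtain ⟨b, hb⟩ := ((tendsto_real_Iic_atTop μ).eventually (lt_mem_nhds h1)).exists
    exact ⟨b, fun t ht => le_of_not_gt fun htb =>
      ((monotone_real_Iic μ htb.le).trans ht).not_gt hb⟩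
  have hc : IsClosed {y | μ.real (Iic y) ≤ u} :=
    isClosed_le (continuous_real_Iic μ) continuous_const
  -- The sublevel set is closed, so when nonempty it lies in the half-line ending at its own
  -- supremum; conversely it contains `Iic y` for a point `y` of level exactly `u`, given by the
  -- intermediate value theorem.
  apply le_antisymm
  · rcases eq_empty_or_nonempty {y | μ.real (Iic y) ≤ u} with he | hne
    · simp [he]
    · have hm := hc.csSup_mem hne hb
      calc μ {y | μ.real (Iic y) ≤ u} ≤ μ (Iic (sSup {y | μ.real (Iic y) ≤ u})) :=
            measure_mono fun y hy => le_csSup hb hy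
        _ = ENNReal.ofReal (μ.real (Iic (sSup {y | μ.real (Iic y) ≤ u}))) := by
            rw [ofReal_measureReal]
        _ ≤ ENNReal.ofReal u := ENNReal.ofReal_le_ofReal hm
  · rcases h0.eq_or_lt with rfl | h0
    · simp
    · obtain ⟨y, hy⟩ : ∃ y, μ.real (Iic y) = u := by
        have := mem_range_of_exists_le_of_exists_ge (continuous_real_Iic μ)
          (((tendsto_real_Iic_atBot μ).eventually (ge_mem_nhds h0)).exists)
          (((tendsto_real_Iic_atTop μ).eventually (le_mem_nhds h1)).exists)
        exact this
      rw [← hy, ofReal_measureReal]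
      exact measure_mono fun z hz => monotone_real_Iic μ hz

theorem measurable_monotoneMap (α β : Measure ℝ) [IsProbabilityMeasure α]
    [IsProbabilityMeasure β] : Measurable (monotoneMap α β) :=
  measurable_sInf_setOf_le (F := fun _ t => β.real (Iic t)) (monotone_real_Iic α).measurable
    (fun _ => measurable_const) (fun _ => monotone_real_Iic β) (fun _ _ => measureReal_nonneg)
    (fun _ => tendsto_real_Iic_atBot β)

/-- Up to a null set, `{T ≤ s}` is `{F_α ≤ F_β(s)}`, which has mass `F_β(s)` because `F_α` is
uniformly distributed under `α`. -/
theorem map_monotoneMap (α β : Measure ℝ) [IsProbabilityMeasure α] [IsProbabilityMeasure β]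
    [NullSingletonClass α] : α.map (monotoneMap α β) = β := by
  have hm := measurable_monotoneMap α β
  have : IsProbabilityMeasure (α.map (monotoneMap α β)) :=
    Measure.isProbabilityMeasure_map hm.aemeasurable
  refine Measure.ext_of_Iic _ _ fun s => ?_
  rw [Measure.map_apply hm measurableSet_Iic]
  -- The levels `0` and `1`, where the infimum may be a default value, carry no mass.
  have h0 : ∀ᵐ x ∂α, 0 < α.real (Iic x) := by
    have := measure_setOf_real_Iic_le α le_rfl zero_le_one
    rw [ENNReal.ofReal_zero] at this
    rw [ae_iff]; simpa using this
  have h1 : ∀ᵐ x ∂α, α.real (Iic x) < 1 := by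
    rw [ae_iff]
    have hle : ∀ u : ℝ, 0 ≤ u → u < 1 → α {x | ¬ α.real (Iic x) < 1} ≤ ENNReal.ofReal (1 - u) := by
      intro u hu0 hu1
      have hms : MeasurableSet {y | α.real (Iic y) ≤ u} :=
        measurableSet_le (monotone_real_Iic α).measurable measurable_const
      calc α {x | ¬ α.real (Iic x) < 1} ≤ α {y | α.real (Iic y) ≤ u}ᶜ :=
            measure_mono fun y hy => by
              simp only [mem_ofPred_eq, not_lt, mem_compl_iff, not_le] at hy ⊢; linarith
        _ = ENNReal.ofReal (1 - u) := by
            rw [prob_compl_eq_one_sub hms, measure_setOf_real_Iic_le α hu0 hu1.le,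
              ENNReal.ofReal_sub _ hu0, ENNReal.ofReal_one]
    have hlim : Tendsto (fun u : ℝ => ENNReal.ofReal (1 - u)) (𝓝[<] 1) (𝓝 0) := by
      have : Tendsto (fun u : ℝ => ENNReal.ofReal (1 - u)) (𝓝 1) (𝓝 (ENNReal.ofReal (1 - 1))) :=
        (ENNReal.continuous_ofReal.comp (continuous_const.sub continuous_id)).tendsto 1
      simpa using this.mono_left nhdsWithin_le_nhds
    refine le_antisymm (ge_of_tendsto hlim ?_) bot_le
    filter_upwards [self_mem_nhdsWithin,
      mem_nhdsWithin_of_mem_nhds (lt_mem_nhds (zero_lt_one' ℝ))] with u hu hu'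
    exact hle u hu'.le hu
  calc α (monotoneMap α β ⁻¹' Iic s) = α {y | α.real (Iic y) ≤ β.real (Iic s)} := by
        refine measure_congr ?_
        filter_upwards [h0, h1] with x hx0 hx1
        obtain ⟨b, hb⟩ := ((tendsto_real_Iic_atTop β).eventually (lt_mem_nhds hx1)).exists
        exact propext (monotoneMap_le_iff hx0 ⟨b, hb.le⟩ s)
    _ = ENNReal.ofReal (β.real (Iic s)) :=
        measure_setOf_real_Iic_le α measureReal_nonneg measureReal_le_one
    _ = β (Iic s) := ofReal_measureReal

/-! ### Averages over the sphere. -/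

section Sphere

open scoped Pointwise

/-- The normalized surface measure on the unit sphere. -/
def unifSphere (d : ℕ) : Measure (S d) := (surf d univ)⁻¹ • surf d

theorem average_surf {d : ℕ} {F : Type*} [NormedAddCommGroup F] [NormedSpace ℝ F] (f : S d → F) :
    ⨍ θ, f θ ∂(surf d) = ∫ θ, f θ ∂(unifSphere d) := rfl

instance (d : ℕ) : IsFiniteMeasure (surf d) := by unfold surf; infer_instance

instance nontrivial_euclidean (d : ℕ) [NeZero d] : Nontrivial (E d) :=
  Module.nontrivial_of_finrank_pos (R := ℝ) (by simpa using Nat.pos_of_ne_zero (NeZero.ne d))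

instance (d : ℕ) [NeZero d] : IsProbabilityMeasure (unifSphere d) := by
  have : NeZero (surf d) := ⟨Measure.toSphere_ne_zero _⟩
  unfold unifSphere
  infer_instance

theorem unifSphere_absolutelyContinuous (d : ℕ) : unifSphere d ≪ surf d :=
  Measure.smul_absolutelyContinuous

/-- The action of a linear isometry on the unit sphere. -/
def sphereMap {d : ℕ} (U : E d ≃ₗᵢ[ℝ] E d) (θ : S d) : S d :=
  ⟨U θ, by simp⟩

theorem continuous_sphereMap {d : ℕ} (U : E d ≃ₗᵢ[ℝ] E d) : Continuous (sphereMap U) :=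
  (U.continuous.comp continuous_subtype_val).subtype_mk _

/-- `toSphere` measures a set through the volume of the cone over it; cones commute with `U`, and
`U` preserves volume. -/
theorem measurePreserving_sphereMap {d : ℕ} (U : E d ≃ₗᵢ[ℝ] E d) :
    MeasurePreserving (sphereMap U) (unifSphere d) (unifSphere d) := by
  have hm := (continuous_sphereMap U).measurable
  have h : MeasurePreserving (sphereMap U) (surf d) (surf d) := by
    refine ⟨hm, Measure.ext fun s hs => ?_⟩
    rw [Measure.map_apply hm hs, surf, Measure.toSphere_apply' _ (hm hs),
      Measure.toSphere_apply' _ hs]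
    congr 1
    have hset : Ioo (0 : ℝ) 1 • (Subtype.val '' (sphereMap U ⁻¹' s)) =
        U ⁻¹' (Ioo (0 : ℝ) 1 • (Subtype.val '' s)) := by
      ext x
      simp only [Set.mem_smul, mem_image, mem_preimage]
      constructor
      · rintro ⟨r, hr, _, ⟨θ, hθ, rfl⟩, rfl⟩
        exact ⟨r, hr, U θ, ⟨sphereMap U θ, hθ, rfl⟩, by simp⟩
      · rintro ⟨r, hr, _, ⟨θ, hθ, rfl⟩, hx⟩
        refine ⟨r, hr, U.symm θ, ⟨sphereMap U.symm θ, ?_, rfl⟩, ?_⟩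
        · have : sphereMap U (sphereMap U.symm θ) = θ := by ext1; simp [sphereMap]
          change sphereMap U (sphereMap U.symm θ) ∈ s; rwa [this]
        · rw [← U.symm_apply_apply x, ← hx]; simp
    rw [hset]
    exact U.measurePreserving.measure_preimage_equiv (f := U.toMeasurableEquiv) _
  exact h.smul_measure _

/-- The reflection in the hyperplane orthogonal to `x - y` maps `x` to `y` and preserves the measure
on the sphere. -/
theorem integral_comp_inner_eq {d : ℕ} {F : Type*} [NormedAddCommGroup F] [NormedSpace ℝ F]
    (f : ℝ → F) {x y : E d} (h : ‖x‖ = ‖y‖) :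
    ∫ θ : S d, f (inner ℝ x (θ : E d)) ∂(unifSphere d)
      = ∫ θ : S d, f (inner ℝ y (θ : E d)) ∂(unifSphere d) := by
  set U : E d ≃ₗᵢ[ℝ] E d := (ℝ ∙ (x - y))ᗮ.reflection
  have hU : U x = y := Submodule.reflection_sub h
  have hemb : MeasurableEmbedding (sphereMap U) :=
    (MeasurableEquiv.mk ⟨sphereMap U, sphereMap U.symm, fun θ => by ext1; simp [sphereMap],
      fun θ => by ext1; simp [sphereMap]⟩ (continuous_sphereMap U).measurable
      (continuous_sphereMap U.symm).measurable).measurableEmbedding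
  rw [← (measurePreserving_sphereMap U).integral_comp hemb
    (fun θ : S d => f (inner ℝ y (θ : E d)))]
  refine integral_congr_ae (.of_forall fun θ => ?_)
  simp only [sphereMap]
  rw [← hU, U.inner_map_map]

theorem continuous_inner_sphere {d : ℕ} (x : E d) :
    Continuous fun θ : S d => (inner ℝ x (θ : E d) : ℝ) :=
  continuous_const.inner continuous_subtype_val

theorem abs_inner_sphere_le {d : ℕ} (x : E d) (θ : S d) : |inner ℝ x (θ : E d)| ≤ ‖x‖ := by
  simpa using abs_real_inner_le_norm x (θ : E d)

theorem sq_inner_sphere_le {d : ℕ} (x : E d) (θ : S d) : inner ℝ x (θ : E d) ^ 2 ≤ ‖x‖ ^ 2 := by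
  rw [← sq_abs]; gcongr; exact abs_inner_sphere_le x θ

theorem integrable_unifSphere {d : ℕ} [NeZero d] {f : S d → ℝ} (hf : Continuous f) :
    Integrable f (unifSphere d) := by
  have : CompactSpace (S d) := isCompact_iff_compactSpace.1 (isCompact_sphere 0 1)
  exact hf.integrable_of_hasCompactSupport (HasCompactSupport.of_compactSpace f)

theorem integral_abs_inner_rpow {d : ℕ} [NeZero d] (p : ℝ) (x : E d) :
    ∫ θ : S d, |inner ℝ x (θ : E d)| ^ p ∂(unifSphere d) = sphereConst d p * ‖x‖ ^ p := by
  set e : E d := EuclideanSpace.single (0 : Fin d) (1 : ℝ) with he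
  have hn : ‖x‖ = ‖‖x‖ • e‖ := by simp [norm_smul, he]
  rw [integral_comp_inner_eq (fun s => |s| ^ p) hn, sphereConst, average_surf,
    ← integral_mul_const]
  refine integral_congr_ae (.of_forall fun θ => ?_)
  simp only [real_inner_smul_left, abs_mul, abs_norm]
  rw [Real.mul_rpow (norm_nonneg _) (abs_nonneg _), mul_comm]

/-- The `d` coordinate directions contribute equally and their squares sum to `1`. This is the
source of every factor `d` in the estimates. -/
theorem integral_sq_inner {d : ℕ} [NeZero d] (x : E d) :
    ∫ θ : S d, inner ℝ x (θ : E d) ^ 2 ∂(unifSphere d) = ‖x‖ ^ 2 / d := by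
  have hd : (d : ℝ) ≠ 0 := Nat.cast_ne_zero.2 (NeZero.ne d)
  have h : ∀ y : E d, ∫ θ : S d, inner ℝ y (θ : E d) ^ 2 ∂(unifSphere d)
      = sphereConst d 2 * ‖y‖ ^ 2 := fun y => by
    simpa using integral_abs_inner_rpow 2 y
  have hsum : ∑ i : Fin d, ∫ θ : S d,
      inner ℝ (EuclideanSpace.single i (1 : ℝ)) (θ : E d) ^ 2 ∂(unifSphere d) = 1 := by
    have hint : ∀ i : Fin d, Integrable (fun θ : S d =>
        (inner ℝ (EuclideanSpace.single i (1 : ℝ)) (θ : E d) : ℝ) ^ 2) (unifSphere d) :=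
      fun i => integrable_unifSphere ((continuous_inner_sphere _).pow 2)
    rw [← integral_finsetSum _ fun i _ => hint i]
    have : ∀ θ : S d, ∑ i : Fin d, inner ℝ (EuclideanSpace.single i (1 : ℝ)) (θ : E d) ^ 2 = 1 := by
      intro θ
      have h1 : ‖(θ : E d)‖ ^ 2 = 1 := by simp
      rw [EuclideanSpace.real_norm_sq_eq] at h1
      simpa [EuclideanSpace.inner_single_left] using h1
    simp [this]
  simp only [h, PiLp.norm_single, norm_one, one_pow, mul_one, Finset.sum_const,
    Finset.card_univ, Fintype.card_fin, nsmul_eq_mul] at hsum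
  rw [h, eq_div_iff hd]
  linear_combination ‖x‖ ^ 2 * hsum

/-- The limiting functional for `G(s) = s^(p/2)`, evaluated at one point of the target; it produces
the constant of the moment bound. -/
theorem lintegral_rpow_inner {d : ℕ} [NeZero d] {p : ℝ} (hp : 0 < p) (x : E d) :
    ∫⁻ θ : S d, ENNReal.ofReal ((d * inner ℝ x (θ : E d) ^ 2) ^ (p / 2)) ∂(unifSphere d)
      = ENNReal.ofReal ((d : ℝ) ^ (p / 2) * sphereConst d p) * ‖x‖ₑ ^ p := by
  have h : ∀ θ : S d, (d * inner ℝ x (θ : E d) ^ 2) ^ (p / 2)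
      = (d : ℝ) ^ (p / 2) * |inner ℝ x (θ : E d)| ^ p := fun θ => by
    rw [Real.mul_rpow (Nat.cast_nonneg d) (sq_nonneg _), ← sq_abs, ← Real.rpow_natCast,
      ← Real.rpow_mul (abs_nonneg _)]
    congr 2; push_cast; ring
  have hc : 0 ≤ sphereConst d p := by
    rw [sphereConst, average_surf]
    exact integral_nonneg fun θ => Real.rpow_nonneg (abs_nonneg _) _
  simp_rw [h]
  rw [← ofReal_integral_eq_lintegral_ofReal, integral_const_mul, integral_abs_inner_rpow,
    ← mul_assoc, ENNReal.ofReal_mul (by positivity), ← ENNReal.ofReal_rpow_of_nonneg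
      (norm_nonneg _) hp.le, ofReal_norm]
  · exact integrable_unifSphere
      (continuous_const.mul ((continuous_inner_sphere x).abs.rpow_const fun _ => Or.inr hp.le))
  · exact .of_forall fun θ => by positivity

end Sphere

/-! ### Convex radial functionals and their approximation by test functions. -/

/-- Smooth, bounded, nondecreasing, nonnegative functions on the line: the derivatives of the
convex functions `G` for which `G(|x|²)` is used as a test function. -/
structure IsProfile (g : ℝ → ℝ) : Prop where
  contDiff : ContDiff ℝ ∞ g
  monotone : Monotone g
  nonneg : ∀ s, 0 ≤ g s
  bounded : ∃ C, ∀ s, g s ≤ C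

/-- The primitive of `g` that vanishes at `0`. -/
def prim (g : ℝ → ℝ) (s : ℝ) : ℝ := ∫ r in (0 : ℝ)..s, g r

namespace IsProfile

variable {g : ℝ → ℝ}

theorem hasDerivAt_prim (hg : IsProfile g) (s : ℝ) : HasDerivAt (prim g) (g s) s :=
  hg.contDiff.continuous.integral_hasStrictDerivAt 0 s |>.hasDerivAt

theorem contDiff_prim (hg : IsProfile g) : ContDiff ℝ ∞ (prim g) := by
  refine contDiff_infty_iff_deriv.2 ⟨fun s => (hg.hasDerivAt_prim s).differentiableAt, ?_⟩
  rw [funext fun s => (hg.hasDerivAt_prim s).deriv]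
  exact hg.contDiff

theorem continuous_prim (hg : IsProfile g) : Continuous (prim g) := hg.contDiff_prim.continuous

theorem monotone_prim (hg : IsProfile g) : Monotone (prim g) :=
  monotone_of_hasDerivAt_nonneg hg.hasDerivAt_prim hg.nonneg

theorem prim_zero : prim g 0 = 0 := by simp [prim]

theorem prim_nonneg (hg : IsProfile g) {s : ℝ} (hs : 0 ≤ s) : 0 ≤ prim g s := by
  rw [← prim_zero (g := g)]; exact hg.monotone_prim hs

/-- Tangent lines lie below the graph of the convex function `prim g`. -/
theorem mul_sub_le (hg : IsProfile g) (s t : ℝ) : g s * (t - s) ≤ prim g t - prim g s := by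
  have hi : ∀ a b, IntervalIntegrable g volume a b := hg.contDiff.continuous.intervalIntegrable
  have h : prim g t - prim g s = ∫ r in s..t, g r :=
    intervalIntegral.integral_interval_sub_left (hi _ _) (hi _ _)
  have hc : g s * (t - s) = ∫ _r in s..t, g s := by simp [mul_comm]
  rw [h, hc]
  rcases le_total s t with hst | hst
  · exact intervalIntegral.integral_mono_on hst (by simp) (hi _ _)
      fun x hx => hg.monotone hx.1
  · rw [intervalIntegral.integral_symm t s, intervalIntegral.integral_symm t s, neg_le_neg_iff]
    exact intervalIntegral.integral_mono_on hst (hi _ _) (by simp)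
      fun x hx => hg.monotone hx.2

theorem prim_le (hg : IsProfile g) {C : ℝ} (hC : ∀ s, g s ≤ C) {s : ℝ} (hs : 0 ≤ s) :
    prim g s ≤ C * s := by
  have h := hg.mul_sub_le s 0
  rw [prim_zero] at h
  nlinarith [mul_le_mul_of_nonneg_right (hC s) hs]

end IsProfile

theorem gradient_comp_norm_sq {d : ℕ} {H : ℝ → ℝ} {H' : ℝ} {x : E d}
    (h : HasDerivAt H H' (‖x‖ ^ 2)) :
    gradient (fun y : E d => H (‖y‖ ^ 2)) x = (2 * H') • x := by
  apply HasGradientAt.gradient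
  rw [hasGradientAt_iff_hasFDerivAt]
  have h1 := h.comp_hasFDerivAt x (hasStrictFDerivAt_norm_sq x).hasFDerivAt
  have h2 : (InnerProductSpace.toDual ℝ (E d)) ((2 * H') • x) = H' • 2 • innerSL ℝ x := by
    ext y
    simp
    ring
  rw [h2]
  exact h1

/-- Approximation of `x ↦ prim g (|x|²)` by test functions with compact support. -/
theorem IsProfile.exists_testFunction {d : ℕ} {g : ℝ → ℝ} (hg : IsProfile g) :
    ∃ (φ : ℕ → E d → ℝ) (C : ℝ), 0 ≤ C ∧
      (∀ n, ContDiff ℝ ∞ (φ n) ∧ HasCompactSupport (φ n)) ∧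
      (∀ n x, |φ n x| ≤ C * ‖x‖ ^ 2) ∧ (∀ n x, ‖gradient (φ n) x‖ ≤ C * ‖x‖) ∧
      (∀ x, ∀ᶠ n in atTop, φ n x = prim g (‖x‖ ^ 2)) ∧
      (∀ x, ∀ᶠ n in atTop, gradient (φ n) x = (2 * g (‖x‖ ^ 2)) • x) := by
  obtain ⟨C, hC⟩ := hg.bounded
  have hC0 : 0 ≤ C := (hg.nonneg 0).trans (hC 0)
  let χ : ContDiffBump (0 : ℝ) := ⟨1, 2, one_pos, one_lt_two⟩
  have hχ : ContDiff ℝ ∞ χ := χ.contDiff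
  have hχd : ∀ s, HasDerivAt χ (deriv χ s) s := fun s =>
    ((hχ.differentiable (by simp)) s).hasDerivAt
  obtain ⟨B, hB⟩ := (hχ.continuous_deriv (by simp)).bounded_above_of_compact_support
    χ.hasCompactSupport.deriv
  have hB0 : 0 ≤ B := (norm_nonneg _).trans (hB 0)
  let N : ℕ → ℝ := fun n => n + 1
  have hN : ∀ n, 0 < N n := fun n => by positivity
  let H : ℕ → ℝ → ℝ := fun n s => prim g s * χ (s / N n)
  have hHd : ∀ n s, HasDerivAt (H n)
      (g s * χ (s / N n) + prim g s * (deriv χ (s / N n) * (1 / N n))) s := fun n s =>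
    (hg.hasDerivAt_prim s).mul ((hχd _).comp s ((hasDerivAt_id s).div_const _))
  have hev : ∀ s : ℝ, 0 ≤ s → ∀ᶠ n in atTop, s / N n < 1 := fun s hs => by
    filter_upwards [eventually_gt_atTop ⌈s⌉₊] with n hn
    rw [div_lt_one (hN n)]
    have := Nat.lt_of_ceil_lt hn
    simp only [N]; linarith
  have hone : ∀ n s, 0 ≤ s → s / N n < 1 → χ (s / N n) = 1 := fun n s hs h =>
    χ.one_of_mem_closedBall (by
      rw [mem_closedBall_zero_iff, Real.norm_of_nonneg (div_nonneg hs (hN n).le)]; exact h.le)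
  -- The cutoff acts in the variable `s = ‖x‖²`. Where `χ'(s / N)` is nonzero, `prim g s ≤ C s ≤ 2 C
  -- N`, which compensates the factor `1 / N` from the chain rule and leaves `2 C B`, uniformly in
  -- `n`.
  refine ⟨fun n x => H n (‖x‖ ^ 2), 2 * (C + 2 * C * B), by positivity, fun n => ⟨?_, ?_⟩, ?_, ?_,
    ?_, ?_⟩
  · exact (hg.contDiff_prim.mul (hχ.comp (contDiff_id.div_const _))).comp (contDiff_norm_sq ℝ)
  · refine HasCompactSupport.intro (isCompact_closedBall (0 : E d) (2 * N n)) fun x hx => ?_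
    rw [mem_closedBall_zero_iff, not_le] at hx
    have hN1 : 1 ≤ N n := by simp [N]
    have : χ (‖x‖ ^ 2 / N n) = 0 := χ.zero_of_le_dist (by
      rw [dist_zero_right, Real.norm_of_nonneg (by have := hN n; positivity), le_div_iff₀ (hN n)]
      change 2 * N n ≤ _
      nlinarith)
    simp [H, this]
  · intro n x
    have h0 := hg.prim_nonneg (sq_nonneg ‖x‖)
    have h1 := hg.prim_le hC (sq_nonneg ‖x‖)
    simp only [H]
    rw [abs_of_nonneg (mul_nonneg h0 χ.nonneg)]
    have h2 := mul_le_of_le_one_right h0 (χ.le_one (x := ‖x‖ ^ 2 / N n))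
    have : 0 ≤ C * B * ‖x‖ ^ 2 := by positivity
    nlinarith [mul_nonneg hC0 (sq_nonneg ‖x‖)]
  · intro n x
    rw [gradient_comp_norm_sq (hHd n _), norm_smul, norm_mul, Real.norm_ofNat]
    gcongr
    refine (norm_add_le _ _).trans (add_le_add ?_ ?_)
    · rw [Real.norm_of_nonneg (mul_nonneg (hg.nonneg _) χ.nonneg)]
      exact (mul_le_of_le_one_right (hg.nonneg _) χ.le_one).trans (hC _)
    · set s := ‖x‖ ^ 2
      have hs : 0 ≤ s := sq_nonneg _
      by_cases h2 : s / N n ≤ 2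
      · rw [norm_mul, norm_mul, Real.norm_of_nonneg (hg.prim_nonneg hs),
          Real.norm_of_nonneg (one_div_nonneg.2 (hN n).le)]
        rw [div_le_iff₀ (hN n)] at h2
        calc prim g s * (‖deriv χ (s / N n)‖ * (1 / N n)) ≤ (C * (2 * N n)) * (B * (1 / N n)) := by
              have := hN n
              gcongr
              · exact (hg.prim_le hC hs).trans (by gcongr)
              · exact hB _
          _ = 2 * C * B := by have := (hN n).ne'; field_simp
      · have : deriv χ (s / N n) = 0 := by
          apply image_eq_zero_of_notMem_tsupport
          intro hmem
          have := tsupport_deriv_subset hmem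
          rw [χ.tsupport_eq, mem_closedBall_zero_iff] at this
          exact h2 ((le_abs_self _).trans this)
        rw [this]; simp; positivity
  · intro x
    filter_upwards [hev _ (sq_nonneg ‖x‖)] with n hn
    simp [H, hone n _ (sq_nonneg _) hn]
  · intro x
    filter_upwards [hev _ (sq_nonneg ‖x‖)] with n hn
    have hs := sq_nonneg ‖x‖
    have hloc : H n =ᶠ[𝓝 (‖x‖ ^ 2)] prim g := by
      have hc : Continuous fun s : ℝ => s / N n := by fun_prop
      have hsmall : ∀ᶠ s in 𝓝 (‖x‖ ^ 2), |s / N n| < 1 :=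
        hc.abs.continuousAt.eventually (gt_mem_nhds (by
          change |‖x‖ ^ 2 / N n| < 1
          rwa [abs_of_nonneg (div_nonneg hs (hN n).le)]))
      filter_upwards [hsmall] with s hs1
      have : χ (s / N n) = 1 := χ.one_of_mem_closedBall (by
        rw [mem_closedBall_zero_iff]; exact hs1.le)
      simp [H, this]
    exact gradient_comp_norm_sq ((hg.hasDerivAt_prim _).congr_of_eventuallyEq hloc)

/-! ### Sliced transport maps and the velocity field. -/

section

variable {d : ℕ}

/-- The family of one-dimensional transport maps `(x, ϑ) ↦ T^ϑ(x · ϑ)`. -/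
def slicedMap (ρ ν : Measure (E d)) (z : E d × S d) : ℝ :=
  monotoneMap (proj ρ z.2) (proj ν z.2) (inner ℝ z.1 (z.2 : E d))

theorem measurable_inner_sphere (θ : S d) : Measurable fun x : E d => (inner ℝ x (θ : E d) : ℝ) :=
  (continuous_id.inner continuous_const).measurable

theorem continuous_inner_prod :
    Continuous fun z : E d × S d => (inner ℝ z.1 (z.2 : E d) : ℝ) :=
  continuous_fst.inner (continuous_subtype_val.comp continuous_snd)

instance (μ : Measure (E d)) [IsProbabilityMeasure μ] (θ : S d) :
    IsProbabilityMeasure (proj μ θ) :=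
  Measure.isProbabilityMeasure_map (measurable_inner_sphere θ).aemeasurable

/-- Joint measurability in point and direction, as Fubini's theorem requires. Masses of half-lines
under `proj` are measures of sections of a measurable set. -/
theorem measurable_slicedMap (ρ ν : Measure (E d)) [IsProbabilityMeasure ρ]
    [IsProbabilityMeasure ν] : Measurable (slicedMap ρ ν) := by
  have hproj : ∀ (μ : Measure (E d)) [IsProbabilityMeasure μ] (f : E d × S d → ℝ),
      Measurable f → Measurable fun z : E d × S d => (proj μ z.2).real (Iic (f z)) := by
    intro μ _ f hf
    have hs : MeasurableSet
        {w : (E d × S d) × E d | (inner ℝ w.2 (w.1.2 : E d) : ℝ) ≤ f w.1} :=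
      measurableSet_le (continuous_inner_prod.measurable.comp
        (measurable_snd.prodMk (measurable_snd.comp measurable_fst))) (hf.comp measurable_fst)
    have h1 : Measurable fun z : E d × S d =>
        (μ (Prod.mk z ⁻¹' {w : (E d × S d) × E d | (inner ℝ w.2 (w.1.2 : E d) : ℝ) ≤ f w.1})).toReal :=
      (measurable_measure_prodMk_left hs).ennreal_toReal
    have h2 : ∀ z : E d × S d, (proj μ z.2).real (Iic (f z)) =
        (μ (Prod.mk z ⁻¹' {w : (E d × S d) × E d | (inner ℝ w.2 (w.1.2 : E d) : ℝ) ≤ f w.1})).toReal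
        := fun z => by
      rw [Measure.real, proj, Measure.map_apply (measurable_inner_sphere _) measurableSet_Iic]
      rfl
    simpa only [h2] using h1
  have key := measurable_sInf_setOf_le
    (a := fun z : E d × S d => (proj ρ z.2).real (Iic (inner ℝ z.1 (z.2 : E d))))
    (F := fun z t => (proj ν z.2).real (Iic t))
    (hproj ρ _ continuous_inner_prod.measurable) (fun t => hproj ν _ measurable_const)
    (fun z => monotone_real_Iic _) (fun _ _ => measureReal_nonneg)
    (fun z => tendsto_real_Iic_atBot _)
  exact key

theorem integrable_norm_sq {μ : Measure (E d)} (h : moment 2 μ < ⊤) :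
    Integrable (fun x : E d => ‖x‖ ^ 2) μ := by
  refine ⟨by fun_prop, ?_⟩
  rw [HasFiniteIntegral]
  refine lt_of_le_of_lt (lintegral_mono fun x => ?_) h
  simp

theorem IsProfile.integrable_prim_norm_sq {g : ℝ → ℝ} (hg : IsProfile g) {μ : Measure (E d)}
    (h : moment 2 μ < ⊤) : Integrable (fun x : E d => prim g (‖x‖ ^ 2)) μ := by
  obtain ⟨C, hC⟩ := hg.bounded
  refine ((integrable_norm_sq h).const_mul C).mono'
    (hg.continuous_prim.comp (by fun_prop)).aestronglyMeasurable (.of_forall fun x => ?_)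
  rw [Real.norm_of_nonneg (hg.prim_nonneg (sq_nonneg _))]
  exact hg.prim_le hC (sq_nonneg _)

variable [NeZero d]

/-- `map_monotoneMap` integrated over directions. Atomlessness enters the flow estimates only
through this identity. -/
theorem map_slicedMap {ρ ν : Measure (E d)} [IsProbabilityMeasure ρ] [IsProbabilityMeasure ν]
    (h : ∀ᵐ θ ∂(surf d), NullSingletonClass (proj ρ θ)) :
    (ρ.prod (unifSphere d)).map (slicedMap ρ ν)
      = (ν.prod (unifSphere d)).map fun z => (inner ℝ z.1 (z.2 : E d) : ℝ) := by
  have hm := measurable_slicedMap ρ ν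
  have hi := (continuous_inner_prod (d := d)).measurable
  ext s hs
  rw [Measure.map_apply hm hs, Measure.map_apply hi hs, Measure.prod_apply_symm (hm hs),
    Measure.prod_apply_symm (hi hs)]
  refine lintegral_congr_ae ?_
  filter_upwards [(unifSphere_absolutelyContinuous d).ae_le h] with θ hθ
  have h1 := congrArg (fun μ => μ s) (map_monotoneMap (proj ρ θ) (proj ν θ))
  simp only [Measure.map_apply (measurable_monotoneMap _ _) hs] at h1
  have h2 : ∀ (μ : Measure (E d)) {u : Set ℝ}, MeasurableSet u →
      proj μ θ u = μ ((fun x => inner ℝ x (θ : E d)) ⁻¹' u) := fun μ _ hu =>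
    Measure.map_apply (measurable_inner_sphere θ) hu
  rw [h2 ρ (measurable_monotoneMap _ _ hs), h2 ν hs] at h1
  exact h1

theorem stronglyMeasurable_velocity (ρ ν : Measure (E d)) [IsProbabilityMeasure ρ]
    [IsProbabilityMeasure ν] : StronglyMeasurable (velocity ρ ν) := by
  have h : Measurable fun z : E d × S d =>
      (slicedMap ρ ν z - inner ℝ z.1 (z.2 : E d)) • (z.2 : E d) :=
    ((measurable_slicedMap ρ ν).sub continuous_inner_prod.measurable).smul
      (measurable_subtype_coe.comp measurable_snd)
  exact h.stronglyMeasurable.integral_prod_right' (ν := unifSphere d)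

/-- Quadratic growth covers both integrands needed below, `s²` and `prim g (d s²)`. -/
theorem integrable_comp_inner {ν : Measure (E d)} [IsProbabilityMeasure ν] (h : moment 2 ν < ⊤)
    {f : ℝ → ℝ} (hf : Continuous f) {C : ℝ} (hC : ∀ s, |f s| ≤ C * s ^ 2) :
    Integrable (fun z : E d × S d => f (inner ℝ z.1 (z.2 : E d))) (ν.prod (unifSphere d)) := by
  have hC0 : 0 ≤ C := by simpa using (abs_nonneg _).trans (hC 1)
  refine (((integrable_norm_sq h).comp_fst (unifSphere d)).const_mul C).mono'
    (hf.comp continuous_inner_prod).aestronglyMeasurable (.of_forall fun z => ?_)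
  exact (hC _).trans (mul_le_mul_of_nonneg_left (sq_inner_sphere_le _ _) hC0)

theorem integrable_comp_slicedMap {ρ ν : Measure (E d)} [IsProbabilityMeasure ρ]
    [IsProbabilityMeasure ν] (h : ∀ᵐ θ ∂(surf d), NullSingletonClass (proj ρ θ))
    (hν : moment 2 ν < ⊤) {f : ℝ → ℝ} (hf : Continuous f) {C : ℝ} (hC : ∀ s, |f s| ≤ C * s ^ 2) :
    Integrable (fun z => f (slicedMap ρ ν z)) (ρ.prod (unifSphere d)) := by
  have h1 := integrable_comp_inner hν hf hC
  have h2 : Integrable f ((ν.prod (unifSphere d)).map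
      fun z => (inner ℝ z.1 (z.2 : E d) : ℝ)) :=
    (integrable_map_measure hf.aestronglyMeasurable
      continuous_inner_prod.measurable.aemeasurable).2 h1
  rw [← map_slicedMap h] at h2
  exact (integrable_map_measure hf.aestronglyMeasurable
    (measurable_slicedMap ρ ν).aemeasurable).1 h2

theorem integral_comp_slicedMap {ρ ν : Measure (E d)} [IsProbabilityMeasure ρ]
    [IsProbabilityMeasure ν] (h : ∀ᵐ θ ∂(surf d), NullSingletonClass (proj ρ θ))
    (hν : moment 2 ν < ⊤) {f : ℝ → ℝ} (hf : Continuous f) {C : ℝ} (hC : ∀ s, |f s| ≤ C * s ^ 2) :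
    ∫ x, ∫ θ, f (slicedMap ρ ν (x, θ)) ∂(unifSphere d) ∂ρ
      = ∫ x, ∫ θ : S d, f (inner ℝ x (θ : E d)) ∂(unifSphere d) ∂ν := by
  rw [← integral_prod (f := fun z => f (slicedMap ρ ν z)) (integrable_comp_slicedMap h hν hf hC),
    ← integral_prod (f := fun z : E d × S d => f (inner ℝ z.1 (z.2 : E d)))
      (integrable_comp_inner hν hf hC),
    ← integral_map (measurable_slicedMap ρ ν).aemeasurable hf.aestronglyMeasurable,
    map_slicedMap h, integral_map continuous_inner_prod.measurable.aemeasurable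
      hf.aestronglyMeasurable]

section Velocity

variable {ρ ν : Measure (E d)} {x : E d}

theorem integrable_velocity_integrand
    (hT : Integrable (fun θ => slicedMap ρ ν (x, θ)) (unifSphere d)) :
    Integrable (fun θ : S d => (slicedMap ρ ν (x, θ) - inner ℝ x (θ : E d)) • (θ : E d))
      (unifSphere d) := by
  refine (hT.sub (integrable_unifSphere (continuous_inner_sphere x))).mono
    ((hT.sub (integrable_unifSphere (continuous_inner_sphere x))).aestronglyMeasurable.smul
      continuous_subtype_val.aestronglyMeasurable) (.of_forall fun θ => ?_)
  simp [norm_smul]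

/-- Supplies the dominating function for `∇φ · v` when `|∇φ| ≤ C |x|`: bound `|v|` by the average of
`|T| + |x|` and split the products by Young's inequality. -/
theorem norm_mul_norm_velocity_le
    (hT : Integrable (fun θ => slicedMap ρ ν (x, θ)) (unifSphere d))
    (hT2 : Integrable (fun θ => slicedMap ρ ν (x, θ) ^ 2) (unifSphere d)) :
    ‖x‖ * ‖velocity ρ ν x‖ ≤ 2 * ‖x‖ ^ 2 + ∫ θ, slicedMap ρ ν (x, θ) ^ 2 ∂(unifSphere d) := by
  have hv : ‖velocity ρ ν x‖ ≤ ∫ θ : S d, |slicedMap ρ ν (x, θ)| + ‖x‖ ∂(unifSphere d) := by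
    rw [velocity, average_surf]
    refine norm_integral_le_of_norm_le (hT.abs.add (integrable_const _)) (.of_forall fun θ => ?_)
    change ‖(slicedMap ρ ν (x, θ) - inner ℝ x (θ : E d)) • (θ : E d)‖ ≤ _
    have := abs_inner_sphere_le x θ
    have h2 := abs_sub (slicedMap ρ ν (x, θ)) (inner ℝ x (θ : E d))
    simp only [norm_smul, norm_eq_of_mem_sphere, mul_one, Real.norm_eq_abs]
    linarith
  calc ‖x‖ * ‖velocity ρ ν x‖
      ≤ ‖x‖ * ∫ θ : S d, |slicedMap ρ ν (x, θ)| + ‖x‖ ∂(unifSphere d) := by gcongr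
    _ = ∫ θ : S d, ‖x‖ * (|slicedMap ρ ν (x, θ)| + ‖x‖) ∂(unifSphere d) := by
        rw [integral_const_mul]
    _ ≤ ∫ θ : S d, 2 * ‖x‖ ^ 2 + slicedMap ρ ν (x, θ) ^ 2 ∂(unifSphere d) := by
        refine integral_mono ((hT.abs.add (integrable_const _)).const_mul _)
          ((integrable_const _).add hT2) fun θ => ?_
        change ‖x‖ * (|slicedMap ρ ν (x, θ)| + ‖x‖) ≤ 2 * ‖x‖ ^ 2 + slicedMap ρ ν (x, θ) ^ 2
        rw [← sq_abs (slicedMap ρ ν (x, θ))]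
        nlinarith [sq_nonneg (‖x‖ - |slicedMap ρ ν (x, θ)|), sq_nonneg ‖x‖,
          sq_nonneg (slicedMap ρ ν (x, θ)), sq_abs (slicedMap ρ ν (x, θ))]
    _ = _ := by
        rw [integral_add (integrable_const _) hT2]; simp

/-- The core inequality, at a fixed point `x`: `2 (T - a) a ≤ T² - a²`, then the tangent line of
`prim g` at `‖x‖²` evaluated at `d T²`. -/
theorem inner_velocity_le {g : ℝ → ℝ} (hg : IsProfile g)
    (hT : Integrable (fun θ => slicedMap ρ ν (x, θ)) (unifSphere d))
    (hT2 : Integrable (fun θ => slicedMap ρ ν (x, θ) ^ 2) (unifSphere d))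
    (hG : Integrable (fun θ => prim g (d * slicedMap ρ ν (x, θ) ^ 2)) (unifSphere d)) :
    inner ℝ ((2 * g (‖x‖ ^ 2)) • x) (velocity ρ ν x)
      ≤ (1 / d) * (∫ θ, prim g (d * slicedMap ρ ν (x, θ) ^ 2) ∂(unifSphere d)
        - prim g (‖x‖ ^ 2)) := by
  have hd : (0 : ℝ) < d := Nat.cast_pos.2 (Nat.pos_of_ne_zero (NeZero.ne d))
  have hI2 : Integrable (fun θ : S d => inner ℝ x (θ : E d) ^ 2) (unifSphere d) :=
    integrable_unifSphere ((continuous_inner_sphere x).pow 2)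
  set s := ‖x‖ ^ 2 with hs
  have hin := integral_inner (𝕜 := ℝ) (integrable_velocity_integrand hT) ((2 * g s) • x)
  change inner ℝ _ (∫ θ : S d, (slicedMap ρ ν (x, θ) - inner ℝ x (θ : E d)) • (θ : E d)
    ∂(unifSphere d)) ≤ _
  rw [← hin]
  calc ∫ θ : S d, inner ℝ ((2 * g s) • x)
        ((slicedMap ρ ν (x, θ) - inner ℝ x (θ : E d)) • (θ : E d)) ∂(unifSphere d)
      ≤ ∫ θ : S d, g s * (slicedMap ρ ν (x, θ) ^ 2 - inner ℝ x (θ : E d) ^ 2)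
          ∂(unifSphere d) := by
        refine integral_mono ((integrable_velocity_integrand hT).const_inner _)
          ((hT2.sub hI2).const_mul _) fun θ => ?_
        simp only [real_inner_smul_left, real_inner_smul_right]
        nlinarith [mul_nonneg (hg.nonneg s)
          (sq_nonneg (slicedMap ρ ν (x, θ) - inner ℝ x (θ : E d)))]
    -- The integrands differ; only the averages agree, since `(x · ϑ)²` has mean `s / d`.
    _ = ∫ θ : S d, (1 / d) * (g s * (d * slicedMap ρ ν (x, θ) ^ 2 - s)) ∂(unifSphere d) := by
        rw [integral_const_mul, integral_sub hT2 hI2, integral_sq_inner, integral_const_mul,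
          integral_const_mul, integral_sub (hT2.const_mul _) (integrable_const _),
          integral_const_mul]
        simp only [integral_const, probReal_univ, one_smul]
        field_simp
        rw [hs]
    _ ≤ ∫ θ : S d, (1 / d) * (prim g (d * slicedMap ρ ν (x, θ) ^ 2) - prim g s)
          ∂(unifSphere d) := by
        refine integral_mono ((((hT2.const_mul _).sub (integrable_const _)).const_mul _).const_mul _)
          ((hG.sub (integrable_const _)).const_mul _) fun θ => ?_
        have := hg.mul_sub_le s (d * slicedMap ρ ν (x, θ) ^ 2)
        dsimp only
        gcongr
    _ = _ := by
        rw [integral_const_mul, integral_sub hG (integrable_const _)]; simp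

end Velocity

/-- The limiting value of the functional with profile `g`. -/
def slicedEnergy (g : ℝ → ℝ) (ν : Measure (E d)) : ℝ :=
  ∫ x, ∫ θ : S d, prim g (d * inner ℝ x (θ : E d) ^ 2) ∂(unifSphere d) ∂ν

theorem IsProfile.continuous_prim_mul_sq {g : ℝ → ℝ} (hg : IsProfile g) (c : ℝ) :
    Continuous fun s : ℝ => prim g (c * s ^ 2) :=
  hg.continuous_prim.comp (by fun_prop)

theorem IsProfile.abs_prim_mul_sq_le {g : ℝ → ℝ} (hg : IsProfile g) {C : ℝ} (hC : ∀ s, g s ≤ C)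
    {c : ℝ} (hc : 0 ≤ c) (s : ℝ) : |prim g (c * s ^ 2)| ≤ (C * c) * s ^ 2 := by
  have h : 0 ≤ c * s ^ 2 := by positivity
  rw [abs_of_nonneg (hg.prim_nonneg h), mul_assoc]
  exact hg.prim_le hC h

section FixedTime

variable {ρ ν : Measure (E d)} [IsProbabilityMeasure ρ] [IsProbabilityMeasure ν]

theorem ae_integrable_slicedMap (h : ∀ᵐ θ ∂(surf d), NullSingletonClass (proj ρ θ))
    (hν : moment 2 ν < ⊤) : ∀ᵐ x ∂ρ,
      Integrable (fun θ => slicedMap ρ ν (x, θ)) (unifSphere d) ∧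
      Integrable (fun θ => slicedMap ρ ν (x, θ) ^ 2) (unifSphere d) := by
  have h2 := integrable_comp_slicedMap h hν (continuous_pow 2) (C := 1) (fun s => by simp)
  filter_upwards [h2.prod_right_ae] with x hx
  have hm : AEStronglyMeasurable (fun θ => slicedMap ρ ν (x, θ)) (unifSphere d) :=
    ((measurable_slicedMap ρ ν).comp measurable_prodMk_left).aestronglyMeasurable
  exact ⟨((memLp_two_iff_integrable_sq hm).2 hx).integrable one_le_two, hx⟩

theorem integrable_integral_slicedMap_sq (h : ∀ᵐ θ ∂(surf d), NullSingletonClass (proj ρ θ))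
    (hν : moment 2 ν < ⊤) :
    Integrable (fun x => ∫ θ, slicedMap ρ ν (x, θ) ^ 2 ∂(unifSphere d)) ρ :=
  (integrable_comp_slicedMap h hν (continuous_pow 2) (C := 1)
    (fun s => by simp)).integral_prod_left

/-- The bound does not depend on `ρ`, hence is uniform in time along a flow. -/
theorem integral_slicedMap_sq_le (h : ∀ᵐ θ ∂(surf d), NullSingletonClass (proj ρ θ))
    (hν : moment 2 ν < ⊤) :
    ∫ x, ∫ θ, slicedMap ρ ν (x, θ) ^ 2 ∂(unifSphere d) ∂ρ ≤ ∫ x, ‖x‖ ^ 2 ∂ν := by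
  rw [integral_comp_slicedMap h hν (continuous_pow 2) (C := 1) (fun s => by simp)]
  refine integral_mono (integrable_comp_inner hν (continuous_pow 2) (C := 1)
    (fun s => by simp)).integral_prod_left (integrable_norm_sq hν) fun x => ?_
  dsimp only
  rw [integral_sq_inner]
  exact div_le_self (sq_nonneg _) (Nat.one_le_cast.2 (Nat.one_le_iff_ne_zero.2 (NeZero.ne d)))

/-- Integrating `inner_velocity_le` and transporting `T` to the target turns the right side into a
closed differential inequality for the functional. -/
theorem integral_inner_velocity_le {g : ℝ → ℝ} (hg : IsProfile g)
    (h : ∀ᵐ θ ∂(surf d), NullSingletonClass (proj ρ θ)) (hρ : moment 2 ρ < ⊤)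
    (hν : moment 2 ν < ⊤) :
    ∫ x, inner ℝ ((2 * g (‖x‖ ^ 2)) • x) (velocity ρ ν x) ∂ρ
      ≤ (1 / d) * (slicedEnergy g ν - ∫ x, prim g (‖x‖ ^ 2) ∂ρ) := by
  obtain ⟨C, hC⟩ := hg.bounded
  have hC0 : 0 ≤ C := (hg.nonneg 0).trans (hC 0)
  have hG := integrable_comp_slicedMap h hν (hg.continuous_prim_mul_sq d)
    (hg.abs_prim_mul_sq_le hC (Nat.cast_nonneg d))
  rw [slicedEnergy, ← integral_comp_slicedMap h hν (hg.continuous_prim_mul_sq d)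
    (hg.abs_prim_mul_sq_le hC (Nat.cast_nonneg d)),
    ← integral_sub hG.integral_prod_left (hg.integrable_prim_norm_sq hρ), ← integral_const_mul]
  have hb : Integrable (fun x => (2 * C) *
      (2 * ‖x‖ ^ 2 + ∫ θ, slicedMap ρ ν (x, θ) ^ 2 ∂(unifSphere d))) ρ :=
    (((integrable_norm_sq hρ).const_mul 2).add (integrable_integral_slicedMap_sq h hν)).const_mul _
  refine integral_mono_ae (hb.mono' ?_ ?_)
    ((hG.integral_prod_left.sub (hg.integrable_prim_norm_sq hρ)).const_mul _) ?_
  · have : Continuous fun x : E d => (2 * g (‖x‖ ^ 2)) • x :=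
      (continuous_const.mul (hg.contDiff.continuous.comp (by fun_prop))).smul continuous_id
    exact this.aestronglyMeasurable.inner (stronglyMeasurable_velocity ρ ν).aestronglyMeasurable
  · filter_upwards [ae_integrable_slicedMap h hν] with x hx
    have h1 := norm_mul_norm_velocity_le hx.1 hx.2
    refine (norm_inner_le_norm _ _).trans ?_
    rw [norm_smul, Real.norm_of_nonneg (mul_nonneg two_pos.le (hg.nonneg _)), mul_assoc]
    have := hC (‖x‖ ^ 2)
    have := hg.nonneg (‖x‖ ^ 2)
    gcongr
  · filter_upwards [ae_integrable_slicedMap h hν, hG.prod_right_ae] with x hx hGx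
    exact inner_velocity_le hg hx.1 hx.2 hGx

end FixedTime

end

/-! ### Transport plans and the evolution of the functionals along the flow. -/

section

variable {d : ℕ}

/-- A strict bound yields a nearly optimal plan, so no existence of optimal plans is needed. -/
theorem exists_plan_of_wasserstein_lt {p : ℝ} (hp : 0 < p) {μ ν : Measure (E d)} {b : ℝ≥0∞}
    (h : wasserstein p μ ν < b) : ∃ γ : Measure (E d × E d), γ.fst = μ ∧ γ.snd = ν ∧
      ∫⁻ z, edist z.1 z.2 ^ p ∂γ < b ^ p := by
  rw [wasserstein, one_div, ENNReal.rpow_inv_lt_iff hp] at h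
  simp only [iInf_lt_iff] at h
  obtain ⟨γ, ⟨h1, h2⟩, h3⟩ := h
  exact ⟨γ, h1, h2, h3⟩

theorem wasserstein_le_of_plan {p : ℝ} (hp : 0 < p) {γ : Measure (E d × E d)} :
    wasserstein p γ.fst γ.snd ≤ (∫⁻ z, edist z.1 z.2 ^ p ∂γ) ^ (1 / p) := by
  unfold wasserstein
  gcongr
  exact iInf₂_le γ ⟨rfl, rfl⟩

theorem lintegral_enorm_fst_rpow (p : ℝ) (γ : Measure (E d × E d)) :
    ∫⁻ z, ‖z.1‖ₑ ^ p ∂γ = moment p γ.fst := by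
  rw [moment, Measure.fst, lintegral_map (by fun_prop) measurable_fst]

theorem lintegral_enorm_snd_rpow (p : ℝ) (γ : Measure (E d × E d)) :
    ∫⁻ z, ‖z.2‖ₑ ^ p ∂γ = moment p γ.snd := by
  rw [moment, Measure.snd, lintegral_map (by fun_prop) measurable_snd]

theorem moment_snd_le {p : ℝ} (hp : 1 ≤ p) (γ : Measure (E d × E d)) :
    moment p γ.snd ≤ 2 ^ (p - 1) * (moment p γ.fst + ∫⁻ z, edist z.1 z.2 ^ p ∂γ) := by
  rw [← lintegral_enorm_snd_rpow, ← lintegral_enorm_fst_rpow,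
    ← lintegral_add_left (by fun_prop), ← lintegral_const_mul' _ _ (by simp)]
  refine lintegral_mono fun z => ?_
  refine le_trans ?_ (ENNReal.rpow_add_le_mul_rpow_add_rpow _ _ hp)
  gcongr
  have h1 : z.2 = z.1 - (z.1 - z.2) := by abel
  calc ‖z.2‖ₑ = ‖z.1 - (z.1 - z.2)‖ₑ := by rw [← h1]
    _ ≤ ‖z.1‖ₑ + ‖z.1 - z.2‖ₑ := enorm_sub_le
    _ = ‖z.1‖ₑ + edist z.1 z.2 := by rw [edist_eq_enorm_sub]

theorem lintegral_edist_rpow_le {p : ℝ} (hp : 1 ≤ p) (γ : Measure (E d × E d)) :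
    ∫⁻ z, edist z.1 z.2 ^ p ∂γ ≤ 2 ^ (p - 1) * (moment p γ.fst + moment p γ.snd) := by
  rw [← lintegral_enorm_snd_rpow, ← lintegral_enorm_fst_rpow,
    ← lintegral_add_left (by fun_prop), ← lintegral_const_mul' _ _ (by simp)]
  refine lintegral_mono fun z => ?_
  refine le_trans ?_ (ENNReal.rpow_add_le_mul_rpow_add_rpow _ _ hp)
  gcongr
  rw [edist_eq_enorm_sub]
  exact enorm_sub_le

theorem integral_norm_sq_eq (μ : Measure (E d)) :
    ∫ x, ‖x‖ ^ 2 ∂μ = (moment 2 μ).toReal := by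
  rw [integral_eq_lintegral_of_nonneg_ae (.of_forall fun x => sq_nonneg _) (by fun_prop), moment]
  congr 1
  refine lintegral_congr fun x => ?_
  rw [← ofReal_norm, ENNReal.ofReal_rpow_of_nonneg (norm_nonneg _) two_pos.le]
  norm_num

namespace IsSlicedWassersteinFlow

variable {ν : Measure (E d)} {ρ : ℝ → Measure (E d)}

theorem exists_integral_norm_sq_le (hρ : IsSlicedWassersteinFlow ν ρ) (T : ℝ) :
    ∃ B : ℝ, ∀ t ∈ Icc 0 T, ∫ x, ‖x‖ ^ 2 ∂(ρ t) ≤ B := by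
  obtain ⟨g, hg0, hgi, hg⟩ := hρ.acCurve
  -- One number strictly above `W_2(ρ_0, ρ_t)` for all `t ≤ T`; the `+ 1` makes the inequality
  -- strict.
  set b : ℝ≥0∞ := ENNReal.ofReal (∫ r in (0 : ℝ)..T, g r) + 1
  have hb : b ≠ ⊤ := by simp [b]
  have hm0 := hρ.moment_two 0 le_rfl
  refine ⟨(2 ^ ((2 : ℝ) - 1) * (moment 2 (ρ 0) + b ^ (2 : ℝ))).toReal, fun t ht => ?_⟩
  have hW : wasserstein 2 (ρ 0) (ρ t) < b := by
    refine (hg 0 t le_rfl ht.1).trans_lt (lt_of_le_of_lt (ENNReal.ofReal_le_ofReal ?_)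
      (ENNReal.lt_add_right ENNReal.ofReal_ne_top one_ne_zero))
    refine intervalIntegral.integral_mono_interval le_rfl ht.1 ht.2 (.of_forall hg0) ?_
    rw [intervalIntegrable_iff_integrableOn_Icc_of_le (ht.1.trans ht.2)]
    exact hgi T
  obtain ⟨γ, h1, h2, h3⟩ := exists_plan_of_wasserstein_lt two_pos hW
  rw [integral_norm_sq_eq]
  refine ENNReal.toReal_mono ?_ ?_
  · exact ENNReal.mul_ne_top (by simp) (ENNReal.add_ne_top.2 ⟨hm0.ne, by simp [hb]⟩)
  · rw [← h1, ← h2]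
    refine (moment_snd_le one_le_two γ).trans ?_
    gcongr

variable [NeZero d]

/-- The rate of change of the functional with profile `g` along the flow. -/
theorem prim_integral_formula (hρ : IsSlicedWassersteinFlow ν ρ) {g : ℝ → ℝ} (hg : IsProfile g)
    {s t : ℝ} (hs : 0 ≤ s) (hst : s ≤ t) :
    IntervalIntegrable
      (fun r => ∫ x, inner ℝ ((2 * g (‖x‖ ^ 2)) • x) (velocity (ρ r) ν x) ∂(ρ r)) volume s t ∧
    ∫ x, prim g (‖x‖ ^ 2) ∂(ρ t) - ∫ x, prim g (‖x‖ ^ 2) ∂(ρ s)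
      = ∫ r in s..t, ∫ x, inner ℝ ((2 * g (‖x‖ ^ 2)) • x) (velocity (ρ r) ν x) ∂(ρ r) := by
  obtain ⟨φ, C, hC, hφ, hφb, hφ', hφl, hφl'⟩ := hg.exists_testFunction (d := d)
  obtain ⟨B, hB⟩ := hρ.exists_integral_norm_sq_le t
  have := hρ.isProb_target
  -- A bound for all `D n r` at once, from `norm_mul_norm_velocity_le`, the second moments `B` on
  -- `[0, t]` and `integral_slicedMap_sq_le`. It permits dominated convergence in time as well as in
  -- space.
  set M : ℝ := C * (2 * B + ∫ x, ‖x‖ ^ 2 ∂ν) with hM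
  let D : ℕ → ℝ → ℝ := fun n r => ∫ x, inner ℝ (gradient (φ n) x) (velocity (ρ r) ν x) ∂(ρ r)
  have hgc : ∀ n, Continuous (gradient (φ n)) := fun n => by
    have h1 := (hφ n).1.continuous_fderiv (by simp)
    exact (InnerProductSpace.toDual ℝ (E d)).symm.continuous.comp h1
  have hcont := fun n => hρ.continuityEq (φ n) (hφ n).1 (hφ n).2 s t hs hst
  have hae : ∀ᵐ r ∂(volume : Measure ℝ), r ∈ uIoc s t → (∀ n, ‖D n r‖ ≤ M) ∧
      Tendsto (fun n => D n r) atTop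
        (𝓝 (∫ x, inner ℝ ((2 * g (‖x‖ ^ 2)) • x) (velocity (ρ r) ν x) ∂(ρ r))) := by
    have := hρ.noAtoms
    rw [ae_restrict_iff' measurableSet_Ici] at this
    filter_upwards [this] with r hr hrI
    rw [uIoc_of_le hst] at hrI
    have hr0 : 0 ≤ r := hs.trans hrI.1.le
    have hna := hr hr0
    have := hρ.isProb r hr0
    have hmr := hρ.moment_two r hr0
    have hb : Integrable (fun x => C *
        (2 * ‖x‖ ^ 2 + ∫ θ, slicedMap (ρ r) ν (x, θ) ^ 2 ∂(unifSphere d))) (ρ r) :=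
      (((integrable_norm_sq hmr).const_mul 2).add
        (integrable_integral_slicedMap_sq hna hρ.moment_target)).const_mul _
    have hbound : ∀ n, ∀ᵐ x ∂(ρ r), ‖(inner ℝ (gradient (φ n) x) (velocity (ρ r) ν x) : ℝ)‖ ≤
        C * (2 * ‖x‖ ^ 2 + ∫ θ, slicedMap (ρ r) ν (x, θ) ^ 2 ∂(unifSphere d)) := fun n => by
      filter_upwards [ae_integrable_slicedMap hna hρ.moment_target] with x hx
      calc ‖(inner ℝ (gradient (φ n) x) (velocity (ρ r) ν x) : ℝ)‖
          ≤ ‖gradient (φ n) x‖ * ‖velocity (ρ r) ν x‖ := norm_inner_le_norm _ _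
        _ ≤ (C * ‖x‖) * ‖velocity (ρ r) ν x‖ := by gcongr; exact hφ' n x
        _ = C * (‖x‖ * ‖velocity (ρ r) ν x‖) := by ring
        _ ≤ _ := by gcongr; exact norm_mul_norm_velocity_le hx.1 hx.2
    constructor
    · intro n
      refine (norm_integral_le_of_norm_le hb (hbound n)).trans ?_
      rw [integral_const_mul, integral_add ((integrable_norm_sq hmr).const_mul 2)
        (integrable_integral_slicedMap_sq hna hρ.moment_target), integral_const_mul]
      have h1 := hB r ⟨hr0, hrI.2⟩
      have h2 := integral_slicedMap_sq_le hna hρ.moment_target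
      rw [hM]
      gcongr
    · refine tendsto_integral_of_dominated_convergence _ (fun n =>
        (hgc n).aestronglyMeasurable.inner (stronglyMeasurable_velocity _ ν).aestronglyMeasurable)
        hb hbound (.of_forall fun x => ?_)
      refine tendsto_const_nhds.congr' ?_
      filter_upwards [hφl' x] with n hn
      rw [hn]
  have haer : ∀ᵐ r ∂(volume.restrict (uIoc s t)), (∀ n, ‖D n r‖ ≤ M) ∧
      Tendsto (fun n => D n r) atTop
        (𝓝 (∫ x, inner ℝ ((2 * g (‖x‖ ^ 2)) • x) (velocity (ρ r) ν x) ∂(ρ r))) := by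
    rwa [ae_restrict_iff' measurableSet_uIoc]
  have hDm : ∀ n, AEStronglyMeasurable (D n) (volume.restrict (uIoc s t)) := fun n =>
    (intervalIntegrable_iff.1 (hcont n).1).aestronglyMeasurable
  constructor
  · rw [intervalIntegrable_iff]
    have hfin : IsFiniteMeasure (volume.restrict (uIoc s t)) := ⟨by simp [uIoc]⟩
    refine Integrable.mono' (integrable_const M)
      (aestronglyMeasurable_of_tendsto_ae atTop hDm (haer.mono fun r hr => hr.2)) ?_
    filter_upwards [haer] with r hr
    exact le_of_tendsto hr.2.norm (.of_forall hr.1)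
  · have hm : ∀ r, 0 ≤ r → Tendsto (fun n => ∫ x, φ n x ∂(ρ r)) atTop
        (𝓝 (∫ x, prim g (‖x‖ ^ 2) ∂(ρ r))) := fun r hr => by
      refine tendsto_integral_of_dominated_convergence (fun x => C * ‖x‖ ^ 2)
        (fun n => (hφ n).1.continuous.aestronglyMeasurable)
        ((integrable_norm_sq (hρ.moment_two r hr)).const_mul _)
        (fun n => .of_forall fun x => hφb n x) (.of_forall fun x => ?_)
      refine tendsto_const_nhds.congr' ?_
      filter_upwards [hφl x] with n hn
      rw [hn]
    refine tendsto_nhds_unique ((hm t (hs.trans hst)).sub (hm s hs)) ?_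
    rw [show (fun n => ∫ x, φ n x ∂(ρ t) - ∫ x, φ n x ∂(ρ s)) = fun n => ∫ r in s..t, D n r from
      funext fun n => (hcont n).2]
    exact intervalIntegral.tendsto_integral_filter_of_dominated_convergence (fun _ => M)
      (.of_forall hDm) (.of_forall fun n => hae.mono fun r hr hrI => (hr hrI).1 n) (by simp)
      (hae.mono fun r hr hrI => (hr hrI).2)

/-- Convex radial functionals of a flow stay below the maximum of their initial value and of the
limiting value determined by the target. -/
theorem integral_prim_le (hρ : IsSlicedWassersteinFlow ν ρ) {g : ℝ → ℝ} (hg : IsProfile g)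
    {t : ℝ} (ht : 0 ≤ t) :
    ∫ x, prim g (‖x‖ ^ 2) ∂(ρ t) ≤ max (∫ x, prim g (‖x‖ ^ 2) ∂(ρ 0)) (slicedEnergy g ν) := by
  set m : ℝ → ℝ := fun r => ∫ x, prim g (‖x‖ ^ 2) ∂(ρ r) with hmdef
  set D : ℝ → ℝ := fun r => ∫ x, inner ℝ ((2 * g (‖x‖ ^ 2)) • x) (velocity (ρ r) ν x) ∂(ρ r)
  set K := max (m 0) (slicedEnergy g ν) with hK
  have := hρ.isProb_target
  have hd : (0 : ℝ) < d := Nat.cast_pos.2 (Nat.pos_of_ne_zero (NeZero.ne d))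
  have hD : ∀ᵐ r ∂(volume : Measure ℝ), 0 ≤ r → D r ≤ (1 / d) * (slicedEnergy g ν - m r) := by
    have := hρ.noAtoms
    rw [ae_restrict_iff' measurableSet_Ici] at this
    filter_upwards [this] with r hr hr0
    have := hρ.isProb r hr0
    exact integral_inner_velocity_le hg (hr hr0) (hρ.moment_two r hr0) hρ.moment_target
  have hmc : ContinuousOn m (Icc 0 t) := by
    have hI := (hρ.prim_integral_formula hg le_rfl ht).1
    have h1 : ContinuousOn (fun r => m 0 + ∫ u in (0 : ℝ)..r, D u) (Icc 0 t) := by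
      have := intervalIntegral.continuousOn_primitive_interval' hI left_mem_uIcc
      rw [uIcc_of_le ht] at this
      exact continuousOn_const.add this
    refine h1.congr fun r hr => ?_
    have := (hρ.prim_integral_formula hg le_rfl hr.1).2
    simp only [m, D]; linarith
  by_contra hlt
  rw [not_le] at hlt
  -- Let `s` be the last time in `[0, t]` with `m ≤ K`. After `s`, `m > K ≥ slicedEnergy g ν` makes
  -- `D ≤ 0` almost everywhere, so `m t ≤ m s ≤ K`, a contradiction.
  have hS : IsCompact (Icc 0 t ∩ {r | m r ≤ K}) := by
    have := hmc.preimage_isClosed_of_isClosed isClosed_Icc (isClosed_Iic (a := K))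
    exact isCompact_Icc.of_isClosed_subset this inter_subset_left
  obtain ⟨s, ⟨⟨hs0, hst⟩, hsK⟩, hmax⟩ := hS.exists_isGreatest ⟨0, ⟨le_rfl, ht⟩,
    show m 0 ≤ K from le_max_left _ _⟩
  have hform := (hρ.prim_integral_formula hg hs0 hst).2
  have hneg : ∫ r in s..t, D r ≤ 0 := by
    rw [intervalIntegral.integral_of_le hst]
    refine integral_nonpos_of_ae ?_
    rw [EventuallyLE, ae_restrict_iff' measurableSet_Ioc]
    filter_upwards [hD] with r hr hrI
    have hr0 := hs0.trans hrI.1.le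
    have hKr : K < m r := lt_of_not_ge fun hle =>
      (hmax ⟨⟨hr0, hrI.2⟩, hle⟩).not_gt hrI.1
    have hle : slicedEnergy g ν - m r ≤ 0 := by linarith [le_max_right (m 0) (slicedEnergy g ν)]
    exact (hr hr0).trans (mul_nonpos_of_nonneg_of_nonpos (by positivity) hle)
  have hsK' : m s ≤ K := hsK
  change m t - m s = ∫ r in s..t, D r at hform
  change K < m t at hlt
  linarith

end IsSlicedWassersteinFlow

end

section

variable {d : ℕ}

/-! ### The bound on the support radius. -/

section SupportRadius

theorem support_subset_closedBall_iff {μ : Measure (E d)} {r : ℝ} :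
    μ.support ⊆ Metric.closedBall (0 : E d) r ↔ ∀ᵐ x ∂μ, ‖x‖ ≤ r := by
  constructor
  · intro h
    filter_upwards [Measure.support_mem_ae (μ := μ)] with x hx
    simpa using h hx
  · intro h
    refine Measure.support_subset_of_isClosed Metric.isClosed_closedBall ?_
    filter_upwards [h] with x hx
    simpa using hx

theorem exists_of_supportRadius_lt {μ : Measure (E d)} {b : ℝ≥0∞} (h : supportRadius μ < b) :
    ∃ r : ℝ, 0 < r ∧ (∀ᵐ x ∂μ, ‖x‖ ≤ r) ∧ ENNReal.ofReal r < b := by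
  simp only [supportRadius, iInf_lt_iff] at h
  obtain ⟨r, hr, hs, hb⟩ := h
  exact ⟨r, hr, support_subset_closedBall_iff.1 hs, hb⟩

/-- The primitive of this profile vanishes on `[0, a]` and is positive beyond, so its integral
detects mass outside a ball. -/
theorem isProfile_smoothTransition (a : ℝ) :
    IsProfile fun s => Real.smoothTransition (s - a) where
  contDiff := Real.smoothTransition.contDiff.comp (contDiff_id.sub contDiff_const)
  monotone := fun s t h => Real.smoothTransition.monotone (by linarith)
  nonneg := fun s => Real.smoothTransition.nonneg _
  bounded := ⟨1, fun s => Real.smoothTransition.le_one _⟩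

theorem prim_smoothTransition_eq_zero {a s : ℝ} (hs : 0 ≤ s) (h : s ≤ a) :
    prim (fun s => Real.smoothTransition (s - a)) s = 0 := by
  have hg := isProfile_smoothTransition a
  have h1 := hg.mul_sub_le s 0
  rw [IsProfile.prim_zero, Real.smoothTransition.zero_of_nonpos (by linarith)] at h1
  have := hg.prim_nonneg hs
  linarith

theorem prim_smoothTransition_pos {a s : ℝ} (ha : 0 ≤ a) (h : a < s) :
    0 < prim (fun s => Real.smoothTransition (s - a)) s := by
  have hg := isProfile_smoothTransition a
  -- The tangent is taken at the midpoint because the slope at `a` itself is zero.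
  have h1 := hg.mul_sub_le ((a + s) / 2) s
  have h2 := hg.prim_nonneg (s := (a + s) / 2) (by linarith)
  have h3 : 0 < Real.smoothTransition ((a + s) / 2 - a) :=
    Real.smoothTransition.pos_of_pos (by linarith)
  have h4 := mul_pos h3 (show 0 < s - (a + s) / 2 by linarith)
  linarith

variable [NeZero d] {ν : Measure (E d)} {ρ : ℝ → Measure (E d)}

/-- For the profile with threshold `R²`, the initial functional is zero, and so is the limiting
value because `d (y · ϑ)² ≤ d |y|² ≤ R²`. The functional is then zero at time `t`. -/
theorem IsSlicedWassersteinFlow.ae_norm_le (hρ : IsSlicedWassersteinFlow ν ρ) {R : ℝ}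
    (h0 : ∀ᵐ x ∂(ρ 0), ‖x‖ ≤ R) (hν : ∀ᵐ y ∂ν, √d * ‖y‖ ≤ R) {t : ℝ} (ht : 0 ≤ t) :
    ∀ᵐ x ∂(ρ t), ‖x‖ ≤ R := by
  have := hρ.isProb_target
  have := hρ.isProb 0 le_rfl
  have hR : 0 ≤ R := by
    obtain ⟨x, hx⟩ := h0.exists
    exact (norm_nonneg x).trans hx
  have hg := isProfile_smoothTransition (R ^ 2)
  have hle := hρ.integral_prim_le hg ht
  have hm0 : ∫ x, prim (fun s => Real.smoothTransition (s - R ^ 2)) (‖x‖ ^ 2) ∂(ρ 0) = 0 := by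
    refine integral_eq_zero_of_ae ?_
    filter_upwards [h0] with x hx
    exact prim_smoothTransition_eq_zero (sq_nonneg _) (by gcongr)
  have hK : slicedEnergy (fun s => Real.smoothTransition (s - R ^ 2)) ν = 0 := by
    refine integral_eq_zero_of_ae ?_
    filter_upwards [hν] with y hy
    refine integral_eq_zero_of_ae (.of_forall fun θ => ?_)
    refine prim_smoothTransition_eq_zero (by positivity) ?_
    calc d * inner ℝ y (θ : E d) ^ 2 ≤ d * ‖y‖ ^ 2 := by
          have := sq_inner_sphere_le y θ
          gcongr
      _ = (√d * ‖y‖) ^ 2 := by rw [mul_pow, Real.sq_sqrt (Nat.cast_nonneg d)]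
      _ ≤ R ^ 2 := by gcongr
  rw [hm0, hK, max_self] at hle
  have h0' : 0 ≤ᵐ[ρ t] fun x : E d =>
      prim (fun s => Real.smoothTransition (s - R ^ 2)) (‖x‖ ^ 2) :=
    .of_forall fun x => hg.prim_nonneg (sq_nonneg _)
  have hz := (integral_eq_zero_iff_of_nonneg_ae h0'
    (hg.integrable_prim_norm_sq (hρ.moment_two t ht))).1 (le_antisymm hle (integral_nonneg_of_ae h0'))
  filter_upwards [hz] with x hx
  by_contra hlt
  rw [not_le] at hlt
  exact (prim_smoothTransition_pos (sq_nonneg R) (show R ^ 2 < ‖x‖ ^ 2 by gcongr)).ne' hx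

theorem IsSlicedWassersteinFlow.supportRadius_le (hρ : IsSlicedWassersteinFlow ν ρ) {t : ℝ}
    (ht : 0 ≤ t) :
    supportRadius (ρ t) ≤ max (supportRadius (ρ 0)) (ENNReal.ofReal √d * supportRadius ν) := by
  have hd : 0 < √(d : ℝ) := Real.sqrt_pos.2 (Nat.cast_pos.2 (Nat.pos_of_ne_zero (NeZero.ne d)))
  have hd0 : ENNReal.ofReal √d ≠ 0 := (ENNReal.ofReal_pos.2 hd).ne'
  -- Testing against every larger `b` covers infinite radii and infima that are not attained, such
  -- as radius `0`.
  refine le_of_forall_gt fun b hb => ?_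
  obtain ⟨h0, h1⟩ := max_lt_iff.1 hb
  rw [mul_comm, ← ENNReal.lt_div_iff_mul_lt (.inl hd0) (.inl ENNReal.ofReal_ne_top)] at h1
  obtain ⟨r, hr, hr0, hrb⟩ := exists_of_supportRadius_lt h0
  obtain ⟨r', hr', hr0', hrb'⟩ := exists_of_supportRadius_lt h1
  rw [ENNReal.lt_div_iff_mul_lt (.inl hd0) (.inl ENNReal.ofReal_ne_top), mul_comm,
    ← ENNReal.ofReal_mul hd.le] at hrb'
  have hs : (ρ t).support ⊆ Metric.closedBall (0 : E d) (max r (√d * r')) := by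
    refine support_subset_closedBall_iff.2 (hρ.ae_norm_le ?_ ?_ ht)
    · filter_upwards [hr0] with x hx using hx.trans (le_max_left _ _)
    · filter_upwards [hr0'] with x hx
      exact (by gcongr : √d * ‖x‖ ≤ √d * r').trans (le_max_right _ _)
  refine lt_of_le_of_lt (iInf_le_of_le _ (iInf₂_le (lt_max_of_lt_left hr) hs)) ?_
  rcases max_cases r (√d * r') with h | h <;> rw [h.1] <;> assumption

end SupportRadius

/-! ### The moment bound. -/

section Moments

/-- A truncation, smooth at the origin and bounded at infinity, of the derivative of
`s ↦ s ^ (p / 2)`. -/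
def powProfile (p : ℝ) (n : ℕ) (s : ℝ) : ℝ :=
  p / 2 * ((n + 1) * s / (n + 1 + s)) ^ (p / 2 - 1) * Real.smoothTransition ((n + 1) * s - 1)

variable {p : ℝ}

theorem powProfile_of_nonpos (n : ℕ) {s : ℝ} (hs : s ≤ 0) : powProfile p n s = 0 := by
  have : Real.smoothTransition ((n + 1) * s - 1) = 0 :=
    Real.smoothTransition.zero_of_nonpos (by nlinarith [(Nat.cast_nonneg n : (0 : ℝ) ≤ n)])
  rw [powProfile, this, mul_zero]

theorem powProfile_nonneg (hp : 2 ≤ p) (n : ℕ) (s : ℝ) : 0 ≤ powProfile p n s := by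
  rcases le_or_gt s 0 with hs | hs
  · rw [powProfile_of_nonpos n hs]
  · have := Real.smoothTransition.nonneg ((n + 1) * s - 1)
    unfold powProfile
    positivity

/-- For `s > 0`, `(n + 1) s / (n + 1 + s)` increases and stays below `n + 1`. The cutoff vanishes
for `s ≤ 1 / (n + 1)`, which removes both the singularity of the power at `0` and the pole at `-(n +
1)`. -/
theorem isProfile_powProfile (hp : 2 ≤ p) (n : ℕ) : IsProfile (powProfile p n) where
  contDiff := by
    refine contDiff_iff_contDiffAt.2 fun s => ?_
    have hn : (0 : ℝ) < n + 1 := by positivity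
    rcases le_or_gt s 0 with hs | hs
    · have h1 : ∀ᶠ u in 𝓝 s, u < 1 / ((n : ℝ) + 1) :=
        gt_mem_nhds (hs.trans_lt (by positivity))
      refine (contDiffAt_const (c := (0 : ℝ))).congr_of_eventuallyEq ?_
      filter_upwards [h1] with u hu
      rw [lt_div_iff₀ hn] at hu
      rw [powProfile, Real.smoothTransition.zero_of_nonpos (by linarith), mul_zero]
    · have h1 : ContDiffAt ℝ ∞ (fun s : ℝ => (n + 1) * s / (n + 1 + s)) s :=
        (contDiffAt_const.mul contDiffAt_id).div (contDiffAt_const.add contDiffAt_id)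
          (by positivity)
      have h2 : (n + 1) * s / (n + 1 + s) ≠ 0 := by positivity
      exact (contDiffAt_const.mul (h1.rpow_const_of_ne h2)).mul
        (Real.smoothTransition.contDiff.contDiffAt.comp s
          ((contDiffAt_const.mul contDiffAt_id).sub contDiffAt_const))
  monotone := by
    intro s t hst
    rcases le_or_gt s 0 with hs | hs
    · rw [powProfile_of_nonpos n hs]; exact powProfile_nonneg hp n t
    · have ht := hs.trans_le hst
      have hfrac : (n + 1) * s / (n + 1 + s) ≤ (n + 1) * t / (n + 1 + t) := by
        rw [div_le_div_iff₀ (by positivity) (by positivity)]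
        nlinarith [mul_nonneg (sq_nonneg ((n : ℝ) + 1)) (sub_nonneg.2 hst)]
      have hτ := Real.smoothTransition.monotone
        (show (n + 1) * s - 1 ≤ (n + 1) * t - 1 by gcongr)
      have h0 := Real.smoothTransition.nonneg ((n + 1) * s - 1)
      unfold powProfile
      have : 0 ≤ p / 2 - 1 := by linarith
      gcongr
  nonneg := powProfile_nonneg hp n
  bounded := by
    refine ⟨p / 2 * (n + 1) ^ (p / 2 - 1), fun s => ?_⟩
    rcases le_or_gt s 0 with hs | hs
    · rw [powProfile_of_nonpos n hs]; positivity
    · have h1 : (n + 1) * s / (n + 1 + s) ≤ n + 1 := by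
        rw [div_le_iff₀ (by positivity)]
        nlinarith [sq_nonneg ((n : ℝ) + 1)]
      have : 0 ≤ p / 2 - 1 := by linarith
      calc powProfile p n s ≤ p / 2 * ((n + 1) * s / (n + 1 + s)) ^ (p / 2 - 1) :=
            mul_le_of_le_one_right (by positivity) (Real.smoothTransition.le_one _)
        _ ≤ _ := by gcongr

theorem powProfile_le (hp : 2 ≤ p) (n : ℕ) {s : ℝ} (hs : 0 ≤ s) :
    powProfile p n s ≤ p / 2 * s ^ (p / 2 - 1) := by
  have h1 : (n + 1) * s / (n + 1 + s) ≤ s := by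
    rw [div_le_iff₀ (by positivity)]
    nlinarith
  have : 0 ≤ p / 2 - 1 := by linarith
  calc powProfile p n s ≤ p / 2 * ((n + 1) * s / (n + 1 + s)) ^ (p / 2 - 1) :=
        mul_le_of_le_one_right (by positivity) (Real.smoothTransition.le_one _)
    _ ≤ _ := by gcongr

/-- The point `s = 0` must be excluded: for `p = 2` the profiles vanish there while `0 ^ 0 = 1`. -/
theorem tendsto_powProfile {s : ℝ} (hs : 0 < s) :
    Tendsto (fun n => powProfile p n s) atTop (𝓝 (p / 2 * s ^ (p / 2 - 1))) := by
  have hn : Tendsto (fun n : ℕ => (n : ℝ) + 1) atTop atTop :=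
    tendsto_natCast_atTop_atTop.atTop_add tendsto_const_nhds
  have h1 : Tendsto (fun n : ℕ => ((n : ℝ) + 1) * s / (n + 1 + s)) atTop (𝓝 s) := by
    have h2 : Tendsto (fun n : ℕ => s - s * (s / (n + 1 + s))) atTop (𝓝 (s - s * 0)) :=
      tendsto_const_nhds.sub (tendsto_const_nhds.mul
        (tendsto_const_nhds.div_atTop (hn.atTop_add tendsto_const_nhds)))
    rw [mul_zero, sub_zero] at h2
    refine h2.congr fun n => ?_
    have : (n : ℝ) + 1 + s ≠ 0 := by positivity
    field_simp
    ring
  have h3 : Tendsto (fun n : ℕ => Real.smoothTransition ((n + 1) * s - 1)) atTop (𝓝 1) := by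
    refine tendsto_const_nhds.congr' ?_
    filter_upwards [(hn.atTop_mul_const hs).eventually_ge_atTop 2] with n h
    exact (Real.smoothTransition.one_of_one_le (by linarith)).symm
  have h4 := ((h1.rpow_const (p := p / 2 - 1) (.inl hs.ne')).const_mul (p / 2)).mul h3
  simpa [powProfile] using h4

theorem integral_mul_rpow (hp : 2 ≤ p) (s : ℝ) :
    ∫ r in (0 : ℝ)..s, p / 2 * r ^ (p / 2 - 1) = s ^ (p / 2) := by
  have hp0 : p / 2 ≠ 0 := by positivity
  rw [intervalIntegral.integral_const_mul, integral_rpow (.inl (by linarith)), sub_add_cancel,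
    Real.zero_rpow hp0]
  field_simp
  ring

theorem intervalIntegrable_mul_rpow (hp : 2 ≤ p) (s : ℝ) :
    IntervalIntegrable (fun r : ℝ => p / 2 * r ^ (p / 2 - 1)) volume 0 s :=
  (intervalIntegral.intervalIntegrable_rpow' (by linarith)).const_mul _

theorem prim_powProfile_le (hp : 2 ≤ p) (n : ℕ) {s : ℝ} (hs : 0 ≤ s) :
    prim (powProfile p n) s ≤ s ^ (p / 2) := by
  rw [← integral_mul_rpow hp]
  exact intervalIntegral.integral_mono_on hs
    ((isProfile_powProfile hp n).contDiff.continuous.intervalIntegrable _ _)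
    (intervalIntegrable_mul_rpow hp s) fun r hr => powProfile_le hp n hr.1

theorem tendsto_prim_powProfile (hp : 2 ≤ p) {s : ℝ} (hs : 0 ≤ s) :
    Tendsto (fun n => prim (powProfile p n) s) atTop (𝓝 (s ^ (p / 2))) := by
  rw [← integral_mul_rpow hp]
  refine intervalIntegral.tendsto_integral_filter_of_dominated_convergence _
    (.of_forall fun n => (isProfile_powProfile hp n).contDiff.continuous.aestronglyMeasurable)
    (.of_forall fun n => .of_forall fun r hr => ?_) (intervalIntegrable_mul_rpow hp s)
    (.of_forall fun r hr => ?_)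
  · rw [uIoc_of_le hs] at hr
    rw [Real.norm_of_nonneg (powProfile_nonneg hp n r)]
    exact powProfile_le hp n hr.1.le
  · rw [uIoc_of_le hs] at hr
    exact tendsto_powProfile hr.1

theorem ofReal_sq_norm_rpow (hp : 2 ≤ p) (x : E d) :
    ENNReal.ofReal ((‖x‖ ^ 2) ^ (p / 2)) = ‖x‖ₑ ^ p := by
  rw [← ofReal_norm, ENNReal.ofReal_rpow_of_nonneg (norm_nonneg _) (by linarith),
    ← Real.rpow_natCast, ← Real.rpow_mul (norm_nonneg _)]
  congr 2
  push_cast; ring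

/-- No integrability is required, so infinite moments of `ρ 0` or `ν` need no separate case. -/
theorem enorm_integral_le_lintegral_of_le {α : Type*} [MeasurableSpace α] {μ : Measure α} {f : α → ℝ}
    {F : α → ℝ≥0∞} (h : ∀ x, ‖f x‖ₑ ≤ F x) : ‖∫ x, f x ∂μ‖ₑ ≤ ∫⁻ x, F x ∂μ :=
  (enorm_integral_le_lintegral_enorm _).trans (lintegral_mono h)

variable [NeZero d] {ν : Measure (E d)} {ρ : ℝ → Measure (E d)}

/-- Truncated functionals lie below the power, which bounds the right side for every `n`; Fatou's
lemma recovers the full moment on the left. -/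
theorem IsSlicedWassersteinFlow.moment_le (hρ : IsSlicedWassersteinFlow ν ρ) (hp : 2 ≤ p) {t : ℝ}
    (ht : 0 ≤ t) :
    moment p (ρ t) ≤ max (moment p (ρ 0))
      (ENNReal.ofReal ((d : ℝ) ^ (p / 2) * sphereConst d p) * moment p ν) := by
  have hg := isProfile_powProfile hp
  have hen : ∀ n {s : ℝ}, 0 ≤ s →
      ‖prim (powProfile p n) s‖ₑ ≤ ENNReal.ofReal (s ^ (p / 2)) := fun n s hs => by
    rw [Real.enorm_of_nonneg ((hg n).prim_nonneg hs)]
    exact ENNReal.ofReal_le_ofReal (prim_powProfile_le hp n hs)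
  have hbound : ∀ n, ∫⁻ x, ENNReal.ofReal (prim (powProfile p n) (‖x‖ ^ 2)) ∂(ρ t) ≤
      max (moment p (ρ 0))
        (ENNReal.ofReal ((d : ℝ) ^ (p / 2) * sphereConst d p) * moment p ν) := by
    intro n
    rw [← ofReal_integral_eq_lintegral_ofReal
      ((hg n).integrable_prim_norm_sq (hρ.moment_two t ht))
      (.of_forall fun x => (hg n).prim_nonneg (sq_nonneg _))]
    refine (ENNReal.ofReal_le_ofReal (hρ.integral_prim_le (hg n) ht)).trans ?_
    rw [ENNReal.ofReal_max]
    refine max_le_max ?_ ?_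
    · refine (Real.ofReal_le_enorm _).trans ?_
      refine enorm_integral_le_lintegral_of_le fun x => ?_
      rw [← ofReal_sq_norm_rpow hp]
      exact hen n (sq_nonneg _)
    · refine (Real.ofReal_le_enorm _).trans ?_
      rw [moment, ← lintegral_const_mul' _ _ ENNReal.ofReal_ne_top]
      refine enorm_integral_le_lintegral_of_le fun x => ?_
      rw [← lintegral_rpow_inner (by linarith)]
      exact enorm_integral_le_lintegral_of_le fun θ => hen n (by positivity)
  calc moment p (ρ t)
      = ∫⁻ x, liminf (fun n => ENNReal.ofReal (prim (powProfile p n) (‖x‖ ^ 2))) atTop ∂(ρ t) := by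
        refine lintegral_congr fun x => ?_
        rw [← ofReal_sq_norm_rpow hp]
        exact (ENNReal.tendsto_ofReal
          (tendsto_prim_powProfile hp (sq_nonneg _))).liminf_eq.symm
    _ ≤ liminf (fun n => ∫⁻ x, ENNReal.ofReal (prim (powProfile p n) (‖x‖ ^ 2)) ∂(ρ t)) atTop :=
        lintegral_liminf_le fun n => ENNReal.measurable_ofReal.comp
          ((hg n).continuous_prim.measurable.comp (by fun_prop))
    _ ≤ _ := liminf_le_of_le (by isBoundedDefault) fun b hb => by
        obtain ⟨n, hn⟩ := hb.exists
        exact hn.trans (hbound n)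

end Moments

end

section

open scoped NNReal

variable {d : ℕ}

/-! ### Building couplings from partial plans. -/

section Coupling

variable {X : Type*} [MeasurableSpace X]

/-- A partial transport plan between two probability measures extends to a transport plan. -/
theorem exists_coupling_of_le {μ ν : Measure X} [IsProbabilityMeasure μ] [IsProbabilityMeasure ν]
    {γ₀ : Measure (X × X)} (h1 : γ₀.fst ≤ μ) (h2 : γ₀.snd ≤ ν) :
    ∃ γ : Measure (X × X), γ.fst = μ ∧ γ.snd = ν ∧ ∀ s, γ s ≤ γ₀ s + (1 - γ₀ univ) := by
  have : IsFiniteMeasure γ₀.fst := isFiniteMeasure_of_le μ h1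
  have : IsFiniteMeasure γ₀.snd := isFiniteMeasure_of_le ν h2
  have hfin : γ₀ univ ≠ ⊤ := by rw [← Measure.fst_univ]; exact measure_ne_top _ _
  set m := 1 - γ₀ univ with hm
  have hm_top : m ≠ ⊤ := by simp [hm]
  have e1 : μ - γ₀.fst + γ₀.fst = μ := Measure.sub_add_cancel_of_le h1
  have e2 : ν - γ₀.snd + γ₀.snd = ν := Measure.sub_add_cancel_of_le h2
  have m1 : (μ - γ₀.fst) univ = m := by
    have := congrArg (fun κ => κ univ) e1
    simp only [Measure.add_apply, measure_univ, Measure.fst_univ] at this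
    exact ENNReal.eq_sub_of_add_eq hfin this
  have m2 : (ν - γ₀.snd) univ = m := by
    have := congrArg (fun κ => κ univ) e2
    simp only [Measure.add_apply, measure_univ, Measure.snd_univ] at this
    exact ENNReal.eq_sub_of_add_eq hfin this
  have hcancel : ∀ κ : Measure X, κ univ = m → m⁻¹ • m • κ = κ := fun κ hκ => by
    rcases eq_or_ne m 0 with h0 | h0
    · rw [h0, Measure.measure_univ_eq_zero] at hκ
      simp [hκ]
    · rw [smul_smul, ENNReal.inv_mul_cancel h0 hm_top, one_smul]
  -- Both remainders have mass `m`, so their product divided by `m` has them as marginals. If `m =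
  -- 0` the remainders vanish and `m⁻¹ = ⊤` is harmless.
  refine ⟨γ₀ + m⁻¹ • (μ - γ₀.fst).prod (ν - γ₀.snd), ?_, ?_, fun s => ?_⟩
  · rw [Measure.fst, Measure.map_add _ _ measurable_fst, Measure.map_smul, Measure.map_fst_prod,
      m2, hcancel _ m1, add_comm]
    exact e1
  · rw [Measure.snd, Measure.map_add _ _ measurable_snd, Measure.map_smul, Measure.map_snd_prod,
      m1, hcancel _ m2, add_comm]
    exact e2
  · rw [Measure.add_apply, Measure.smul_apply, smul_eq_mul]
    gcongr
    calc m⁻¹ * (μ - γ₀.fst).prod (ν - γ₀.snd) s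
        ≤ m⁻¹ * (μ - γ₀.fst).prod (ν - γ₀.snd) univ := by gcongr; exact subset_univ s
      _ = m⁻¹ * m * m := by rw [← univ_prod_univ, Measure.prod_prod, m1, m2, mul_assoc]
      _ ≤ 1 * m := by gcongr; exact ENNReal.inv_mul_le_one m
      _ = m := one_mul m

/-- Two probability measures can be coupled along a family of functions with sum at most one: the
coupling leaves the sets where these functions are positive with small probability. -/
theorem exists_coupling_of_sum_le_one {ι : Type*} (t : Finset ι) {f : ι → X → ℝ≥0∞}
    (hf : ∀ i, Measurable (f i)) (hsum : ∀ x, ∑ i ∈ t, f i x ≤ 1)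
    (μ ν : Measure X) [IsProbabilityMeasure μ] [IsProbabilityMeasure ν] {s : Set (X × X)}
    (hs : ∀ i ∈ t, ∀ z ∈ s, f i z.1 = 0 ∨ f i z.2 = 0) :
    ∃ γ : Measure (X × X), γ.fst = μ ∧ γ.snd = ν ∧
      γ s ≤ 1 - ∑ i ∈ t, min (∫⁻ x, f i x ∂μ) (∫⁻ x, f i x ∂ν) := by
  set a : ι → ℝ≥0∞ := fun i => ∫⁻ x, f i x ∂μ
  set b : ι → ℝ≥0∞ := fun i => ∫⁻ x, f i x ∂ν
  have hle : ∀ i ∈ t, ∀ x, f i x ≤ 1 := fun i hi x =>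
    (Finset.single_le_sum (f := fun i => f i x) (fun _ _ => bot_le) hi).trans (hsum x)
  have hint_le : ∀ (κ : Measure X) [IsProbabilityMeasure κ], ∀ i ∈ t, ∫⁻ x, f i x ∂κ ≤ 1 :=
    fun κ _ i hi => (lintegral_mono (hle i hi)).trans (by simp)
  have ha : ∀ i ∈ t, a i ≠ ⊤ := fun i hi => ((hint_le μ i hi).trans_lt ENNReal.one_lt_top).ne
  have hb : ∀ i ∈ t, b i ≠ ⊤ := fun i hi => ((hint_le ν i hi).trans_lt ENNReal.one_lt_top).ne
  -- The weight gives the `i`-th product plan mass `min (a i) (b i)` and keeps its marginals below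
  -- `f i μ` and `f i ν`. When `a i * b i = 0` the convention `0 / 0 = 0` gives weight `0`.
  let c : ι → ℝ≥0∞ := fun i => min (a i) (b i) / (a i * b i)
  have hcab : ∀ i ∈ t, c i * (a i * b i) = min (a i) (b i) := fun i hi => by
    rcases eq_or_ne (a i * b i) 0 with h | h
    · rw [h, mul_zero]
      rcases mul_eq_zero.1 h with h | h <;> simp [h]
    · exact ENNReal.div_mul_cancel h (ENNReal.mul_ne_top (ha i hi) (hb i hi))
  have hca : ∀ i ∈ t, c i * a i ≤ 1 := fun i hi => by
    rcases eq_or_ne (b i) 0 with h | h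
    · simp [c, h]
    · have h1 : c i * a i * b i ≤ 1 * b i := by
        rw [mul_assoc, hcab i hi, one_mul]; exact min_le_right _ _
      exact (ENNReal.mul_le_mul_iff_left h (hb i hi)).1 h1
  have hcb : ∀ i ∈ t, c i * b i ≤ 1 := fun i hi => by
    rcases eq_or_ne (a i) 0 with h | h
    · simp [c, h]
    · have h1 : c i * b i * a i ≤ 1 * a i := by
        rw [mul_assoc, mul_comm (b i), hcab i hi, one_mul]; exact min_le_left _ _
      exact (ENNReal.mul_le_mul_iff_left h (ha i hi)).1 h1
  have hfinm : ∀ i ∈ t, IsFiniteMeasure (μ.withDensity (f i)) := fun i hi =>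
    isFiniteMeasure_withDensity (ha i hi)
  have hfinn : ∀ i ∈ t, IsFiniteMeasure (ν.withDensity (f i)) := fun i hi =>
    isFiniteMeasure_withDensity (hb i hi)
  have hau : ∀ i, (μ.withDensity (f i)) univ = a i := fun i => by
    rw [withDensity_apply _ MeasurableSet.univ, Measure.restrict_univ]
  have hbu : ∀ i, (ν.withDensity (f i)) univ = b i := fun i => by
    rw [withDensity_apply _ MeasurableSet.univ, Measure.restrict_univ]
  have hsub : ∀ (κ : Measure X) {u : Set X}, MeasurableSet u →
      ∑ i ∈ t, (κ.withDensity (f i)) u ≤ κ u := fun κ u hu => by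
    simp_rw [withDensity_apply _ hu]
    rw [← lintegral_finsetSum _ fun i _ => hf i]
    exact (lintegral_mono hsum).trans (by simp)
  let γ₀ : Measure (X × X) := ∑ i ∈ t, c i • (μ.withDensity (f i)).prod (ν.withDensity (f i))
  have hγ : ∀ u, γ₀ u = ∑ i ∈ t, c i * (μ.withDensity (f i)).prod (ν.withDensity (f i)) u :=
    fun u => by simp [γ₀, Measure.finsetSum_apply]
  have h1 : γ₀.fst ≤ μ := Measure.le_iff.2 fun u hu => by
    rw [Measure.fst_apply hu, hγ]
    refine le_trans (Finset.sum_le_sum fun i hi => ?_) (hsub μ hu)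
    have := hfinm i hi
    have := hfinn i hi
    rw [← prod_univ, Measure.prod_prod, hbu, mul_comm (μ.withDensity (f i) u), ← mul_assoc]
    exact mul_le_of_le_one_left' (hcb i hi)
  have h2 : γ₀.snd ≤ ν := Measure.le_iff.2 fun u hu => by
    rw [Measure.snd_apply hu, hγ]
    refine le_trans (Finset.sum_le_sum fun i hi => ?_) (hsub ν hu)
    have := hfinm i hi
    have := hfinn i hi
    rw [← univ_prod, Measure.prod_prod, hau, ← mul_assoc]
    exact mul_le_of_le_one_left' (hca i hi)
  have hu : γ₀ univ = ∑ i ∈ t, min (a i) (b i) := by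
    rw [hγ]
    refine Finset.sum_congr rfl fun i hi => ?_
    have := hfinm i hi
    have := hfinn i hi
    rw [← univ_prod_univ, Measure.prod_prod, hau, hbu, hcab i hi]
  have h0 : γ₀ s = 0 := by
    rw [hγ]
    refine Finset.sum_eq_zero fun i hi => ?_
    have := hfinm i hi
    have := hfinn i hi
    have hz : ∀ κ : Measure X, (κ.withDensity (f i)) {x | f i x = 0} = 0 := fun κ => by
      have hms : MeasurableSet {x | f i x = 0} := hf i (measurableSet_singleton 0)
      rw [withDensity_apply _ hms]
      exact (setLIntegral_congr_fun hms fun x hx => hx).trans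
        lintegral_zero
    have hsubset : s ⊆ {x | f i x = 0} ×ˢ univ ∪ univ ×ˢ {x | f i x = 0} := fun z hz => by
      rcases hs i hi z hz with h | h
      · exact .inl ⟨h, mem_univ _⟩
      · exact .inr ⟨mem_univ _, h⟩
    rw [measure_mono_null hsubset (measure_union_null
      (by rw [Measure.prod_prod, hz, zero_mul]) (by rw [Measure.prod_prod, hz, mul_zero])),
      mul_zero]
  obtain ⟨γ, g1, g2, g3⟩ := exists_coupling_of_le h1 h2
  refine ⟨γ, g1, g2, (g3 s).trans ?_⟩
  rw [h0, hu, zero_add]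

end Coupling

/-! ### Weak convergence yields couplings close to the diagonal. -/

section WeakConvergence

/-- A continuous partition of unity on a compact set, subordinate to balls of radius `2r`. -/
theorem exists_partition_of_isCompact {X : Type*} [PseudoMetricSpace X] {K : Set X}
    (hK : IsCompact K) {r : ℝ≥0} (hr : 0 < r) :
    ∃ (t : Finset X) (f : X → BoundedContinuousFunction X ℝ≥0),
      (∀ x, ∑ i ∈ t, f i x ≤ 1) ∧ (∀ x ∈ K, ∑ i ∈ t, f i x = 1) ∧
      ∀ i x, f i x ≠ 0 → nndist x i < 2 * r := by
  obtain ⟨t, -, htfin, htK⟩ := hK.finite_cover_balls (show (0 : ℝ) < r from hr)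
  set t' := htfin.toFinset with ht'
  let φ : X → X → ℝ≥0 := fun i x => 2 * r - nndist x i
  have hφ : ∀ i, Continuous (φ i) := fun i => by fun_prop
  -- The maximum with `r` prevents division by zero; on `K` some `φ i` is at least `r`, so there `S`
  -- is the sum itself.
  let S : X → ℝ≥0 := fun x => max r (∑ i ∈ t', φ i x)
  have hS : Continuous S := continuous_const.max (continuous_finsetSum _ fun i _ => hφ i)
  have hS0 : ∀ x, S x ≠ 0 := fun x => (lt_max_of_lt_left hr).ne'
  -- The minimum only ensures boundedness for indices outside `t'`; for `i ∈ t'` it is inactive.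
  let h : X → X → ℝ≥0 := fun i x => min 1 (φ i x / S x)
  have hc : ∀ i, Continuous (h i) := fun i => continuous_const.min ((hφ i).div₀ hS hS0)
  have hb : ∀ i x y, dist (h i x) (h i y) ≤ 1 := fun i x y => by
    have hx : (h i x : ℝ) ≤ 1 := min_le_left _ _
    have hy : (h i y : ℝ) ≤ 1 := min_le_left _ _
    rw [NNReal.dist_eq, abs_le]
    constructor <;> linarith [(h i x).coe_nonneg, (h i y).coe_nonneg]
  have hh : ∀ x, ∀ i ∈ t', h i x = φ i x / S x := fun x i hi => by
    refine min_eq_right (div_le_one_of_le₀ ?_ bot_le)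
    exact (Finset.single_le_sum (f := fun i => φ i x) (fun _ _ => bot_le) hi).trans
      (le_max_right _ _)
  have hsum : ∀ x, ∑ i ∈ t', h i x = (∑ i ∈ t', φ i x) / S x := fun x => by
    rw [Finset.sum_congr rfl (hh x), Finset.sum_div]
  refine ⟨t', fun i => .mkOfBound ⟨h i, hc i⟩ 1 (hb i), fun x => ?_, fun x hx => ?_,
    fun i x hne => ?_⟩
  · change ∑ i ∈ t', h i x ≤ 1
    rw [hsum]
    exact div_le_one_of_le₀ (le_max_right _ _) bot_le
  · change ∑ i ∈ t', h i x = 1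
    obtain ⟨i, hi, hxi⟩ := mem_iUnion₂.1 (htK hx)
    have hi' : i ∈ t' := htfin.mem_toFinset.2 hi
    have h1 : r ≤ φ i x := by
      refine le_tsub_of_add_le_left ?_
      have : nndist x i ≤ r := by
        rw [← NNReal.coe_le_coe, coe_nndist]; exact (Metric.mem_ball.1 hxi).le
      rw [two_mul]; gcongr
    have h2 : r ≤ ∑ i ∈ t', φ i x :=
      h1.trans (Finset.single_le_sum (f := fun i => φ i x) (fun _ _ => bot_le) hi')
    have h3 : S x = ∑ i ∈ t', φ i x := max_eq_right h2
    rw [hsum, ← h3, div_self (hS0 x)]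
  · by_contra hlt
    rw [not_lt] at hlt
    apply hne
    change min 1 (φ i x / S x) = 0
    simp [φ, tsub_eq_zero_of_le hlt]

/-- Weakly convergent sequences can be coupled with their limit, up to an error that is small
with high probability. -/
theorem eventually_exists_coupling_of_tendsto {u : ℕ → ProbabilityMeasure (E d)}
    {μ : ProbabilityMeasure (E d)} (h : Tendsto u atTop (𝓝 μ)) {δ η : ℝ≥0∞} (hδ : δ ≠ 0)
    (hη : η ≠ 0) :
    ∀ᶠ n in atTop, ∃ γ : Measure (E d × E d), γ.fst = u n ∧ γ.snd = μ ∧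
      γ {z | δ ≤ edist z.1 z.2} ≤ η := by
  -- Two points where the same `f i` is nonzero lie in a ball of radius `2 r`, hence less than `4 r`
  -- apart.
  obtain ⟨r, hr, hrδ⟩ : ∃ r : ℝ≥0, 0 < r ∧ (4 * r : ℝ≥0∞) ≤ δ := by
    obtain ⟨r, hr0, hr⟩ := ENNReal.lt_iff_exists_nnreal_btwn.1
      (ENNReal.div_pos hδ (show (4 : ℝ≥0∞) ≠ ⊤ by simp))
    refine ⟨r, by simpa using hr0, ?_⟩
    rw [mul_comm]
    exact ENNReal.mul_le_of_le_div hr.le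
  obtain ⟨K, hK, hKμ⟩ := isTightMeasureSet_iff_exists_isCompact_measure_compl_le.1
    (isTightMeasureSet_singleton (μ := (μ : Measure (E d)))) (η / 2) (ENNReal.half_pos hη)
  replace hKμ := hKμ _ rfl
  obtain ⟨t, f, hf1, hfK, hfs⟩ := exists_partition_of_isCompact hK hr
  -- Half of `η` pays for the mass outside `K`; the other half makes `hgt` strict (for finite `η`),
  -- hence stable under weak convergence.
  have hmass : 1 ≤ ∑ i ∈ t, ∫⁻ x, f i x ∂(μ : Measure (E d)) + η / 2 := by
    have h1 : (μ : Measure (E d)) K ≤ ∑ i ∈ t, ∫⁻ x, f i x ∂(μ : Measure (E d)) := by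
      rw [← lintegral_finsetSum _ fun i _ => by fun_prop, ← lintegral_indicator_one hK.measurableSet]
      refine lintegral_mono (indicator_le fun x hx => ?_)
      rw [← ENNReal.ofNNReal_finsetSum, hfK x hx]; simp
    calc (1 : ℝ≥0∞) = (μ : Measure (E d)) K + (μ : Measure (E d)) Kᶜ := by
          rw [measure_add_measure_compl hK.measurableSet, measure_univ]
      _ ≤ _ := add_le_add h1 hKμ
  have hlim : Tendsto (fun n => ∑ i ∈ t, min (∫⁻ x, f i x ∂(u n : Measure (E d)))
      (∫⁻ x, f i x ∂(μ : Measure (E d))) + η) atTop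
      (𝓝 (∑ i ∈ t, ∫⁻ x, f i x ∂(μ : Measure (E d)) + η)) := by
    refine Tendsto.add (tendsto_finsetSum _ fun i _ => ?_) tendsto_const_nhds
    have := (ProbabilityMeasure.tendsto_iff_forall_lintegral_tendsto.1 h (f i)).min
      (tendsto_const_nhds (x := ∫⁻ x, f i x ∂(μ : Measure (E d))))
    rwa [min_self] at this
  have hgt : 1 < ∑ i ∈ t, ∫⁻ x, f i x ∂(μ : Measure (E d)) + η := by
    rcases eq_or_ne η ⊤ with rfl | htop
    · simp
    refine hmass.trans_lt ?_
    have hne : ∑ i ∈ t, ∫⁻ x, f i x ∂(μ : Measure (E d)) ≠ ⊤ := by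
      refine ENNReal.sum_ne_top.2 fun i _ => ?_
      exact ((f i).lintegral_lt_top_of_nnreal _).ne
    exact ENNReal.add_lt_add_left hne (ENNReal.half_lt_self hη htop)
  filter_upwards [hlim.eventually (lt_mem_nhds hgt)] with n hn
  obtain ⟨γ, g1, g2, g3⟩ := exists_coupling_of_sum_le_one t
    (f := fun i x => (f i x : ℝ≥0∞)) (fun i => by fun_prop)
    (fun x => by rw [← ENNReal.ofNNReal_finsetSum]; exact_mod_cast hf1 x)
    (u n : Measure (E d)) (μ : Measure (E d)) (s := {z | δ ≤ edist z.1 z.2}) (by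
      intro i _ z hz
      by_contra hne
      simp only [ENNReal.coe_eq_zero, not_or] at hne
      have h1 := hfs i _ hne.1
      have h2 := hfs i _ hne.2
      have h3 : nndist z.1 z.2 < 4 * r := by
        calc nndist z.1 z.2 ≤ nndist z.1 i + nndist z.2 i := nndist_triangle_right _ _ _
          _ < 2 * r + 2 * r := add_lt_add h1 h2
          _ = 4 * r := by ring
      have h4 : edist z.1 z.2 < δ := by
        rw [edist_nndist]
        exact lt_of_lt_of_le (by exact_mod_cast h3) hrδ
      exact h4.not_ge hz)
  exact ⟨γ, g1, g2, g3.trans (tsub_le_iff_left.2 hn.le)⟩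

end WeakConvergence

/-! ### From couplings and moment bounds to `W_q` convergence and compactness. -/

section Criterion

/-- Three ranges: `z ^ q < ε` below `δ = ε^(1/q)`, `z ^ q ≤ ε z ^ p` above `R = ε^(-1/(p-q))`, and
`z ^ q ≤ R ^ q = C` in between. -/
theorem exists_rpow_le_of_lt {q p : ℝ} (hq : 0 < q) (hqp : q < p) {ε : ℝ≥0∞} (h0 : ε ≠ 0)
    (ht : ε ≠ ⊤) : ∃ δ C : ℝ≥0∞, δ ≠ 0 ∧ δ ≠ ⊤ ∧ C ≠ ⊤ ∧
      ∀ z : ℝ≥0∞, z ^ q ≤ ε + (Ici δ).indicator (fun _ => C) z + ε * z ^ p := by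
  set R : ℝ≥0∞ := (ε⁻¹) ^ (p - q)⁻¹ with hR
  have hpq : 0 < p - q := sub_pos.2 hqp
  refine ⟨ε ^ q⁻¹, R ^ q, by simp [h0, ht], by simp [ht, hq.le], ?_, fun z => ?_⟩
  · exact ENNReal.rpow_ne_top_of_nonneg hq.le
      (ENNReal.rpow_ne_top_of_nonneg (inv_nonneg.2 hpq.le) (ENNReal.inv_ne_top.2 h0))
  rcases lt_or_ge z (ε ^ q⁻¹) with hz | hz
  · rw [ENNReal.lt_rpow_inv_iff hq] at hz
    exact hz.le.trans (by rw [add_assoc]; exact le_self_add)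
  · rw [indicator_of_mem (mem_Ici.2 hz)]
    rcases le_total z R with hzR | hzR
    · calc z ^ q ≤ R ^ q := by gcongr
        _ ≤ ε + R ^ q := le_add_self
        _ ≤ _ := le_self_add
    · refine le_trans ?_ le_add_self
      have h1 : ε⁻¹ ≤ z ^ (p - q) := by
        rw [← ENNReal.rpow_inv_le_iff hpq]; exact hzR
      calc z ^ q = ε * (z ^ q * ε⁻¹) := by
            rw [mul_comm (z ^ q), ← mul_assoc, ENNReal.mul_inv_cancel h0 ht, one_mul]
        _ ≤ ε * (z ^ q * z ^ (p - q)) := by gcongr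
        _ = ε * z ^ p := by
            rw [← ENNReal.rpow_add_of_nonneg _ _ hq.le hpq.le, add_sub_cancel]

/-- Convergence in probability under couplings and a uniform bound on the moments of order `p`
imply convergence in the Wasserstein distance of order `q < p`. -/
theorem tendsto_wasserstein {ι : Type*} {l : Filter ι} {u : ι → Measure (E d)}
    {μ : Measure (E d)} [IsProbabilityMeasure μ] {q p : ℝ} (hq : 1 ≤ q) (hqp : q < p) {B : ℝ≥0∞}
    (hB : B ≠ ⊤) (hu : ∀ᶠ i in l, moment p (u i) ≤ B) (hμ : moment p μ ≤ B)
    (h : ∀ δ η : ℝ≥0∞, δ ≠ 0 → δ ≠ ⊤ → η ≠ 0 → ∀ᶠ i in l, ∃ γ : Measure (E d × E d),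
      γ.fst = u i ∧ γ.snd = μ ∧ γ {z | δ ≤ edist z.1 z.2} ≤ η) :
    Tendsto (fun i => wasserstein q (u i) μ) l (𝓝 0) := by
  have hq0 : 0 < q := one_pos.trans_le hq
  refine ENNReal.tendsto_nhds_zero.2 fun τ hτ => ?_
  rcases eq_or_ne τ ⊤ with rfl | hτt
  · simp
  -- The budget `τ ^ q` is split into two halves `κ`. With `ε = κ / A`, the terms `ε` and `ε z ^ p`
  -- cost at most `ε A = κ`, the `+ 1` in `A` paying for the constant term; the middle range costs
  -- at most `C κ / (C + 1) ≤ κ`.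
  set A : ℝ≥0∞ := 2 ^ (p - 1) * (B + B) + 1 with hA
  have hAt : A ≠ ⊤ := by
    refine ENNReal.add_ne_top.2 ⟨ENNReal.mul_ne_top (by simp) (by simp [hB]), by simp⟩
  have hA0 : A ≠ 0 := by simp [hA]
  set κ : ℝ≥0∞ := τ ^ q / 2 with hκ
  have hκ0 : κ ≠ 0 := by
    simp [hκ, hτ.ne', hτt]
  have hκt : κ ≠ ⊤ := ENNReal.div_ne_top (ENNReal.rpow_ne_top_of_nonneg hq0.le hτt) (by simp)
  obtain ⟨δ, C, hδ0, hδt, hC, hz⟩ := exists_rpow_le_of_lt hq0 hqp (ε := κ / A)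
    (ENNReal.div_ne_zero.2 ⟨hκ0, hAt⟩) (ENNReal.div_ne_top hκt hA0)
  have hη : κ / (C + 1) ≠ 0 := ENNReal.div_ne_zero.2 ⟨hκ0, by simp [hC]⟩
  filter_upwards [hu, h δ (κ / (C + 1)) hδ0 hδt hη] with i hi ⟨γ, g1, g2, g3⟩
  have hγ : γ univ = 1 := by rw [← Measure.snd_univ, g2, measure_univ]
  have hms : MeasurableSet {z : E d × E d | δ ≤ edist z.1 z.2} :=
    measurableSet_le measurable_const (by fun_prop)
  have hcost : ∫⁻ z, edist z.1 z.2 ^ q ∂γ ≤ τ ^ q := by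
    calc ∫⁻ z, edist z.1 z.2 ^ q ∂γ
        ≤ ∫⁻ z, (κ / A + {z : E d × E d | δ ≤ edist z.1 z.2}.indicator (fun _ => C) z
            + κ / A * edist z.1 z.2 ^ p) ∂γ := lintegral_mono fun z => hz _
      _ = κ / A + C * γ {z | δ ≤ edist z.1 z.2} + κ / A * ∫⁻ z, edist z.1 z.2 ^ p ∂γ := by
          rw [lintegral_add_right _ (by fun_prop), lintegral_add_left measurable_const,
            lintegral_const, hγ, mul_one, lintegral_indicator_const hms,
            lintegral_const_mul _ (by fun_prop)]
      _ ≤ κ / A + (C + 1) * (κ / (C + 1)) + κ / A * (2 ^ (p - 1) * (B + B)) := by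
          gcongr
          · exact le_self_add
          · refine (lintegral_edist_rpow_le (by linarith) γ).trans ?_
            rw [g1, g2]
            gcongr
      _ = κ / A * A + (C + 1) * (κ / (C + 1)) := by rw [hA]; ring
      _ = κ + κ := by
          rw [ENNReal.div_mul_cancel hA0 hAt, ENNReal.mul_div_cancel (by simp) (by simp [hC])]
      _ = τ ^ q := ENNReal.add_halves _
  have := wasserstein_le_of_plan hq0 (γ := γ)
  rw [g1, g2] at this
  refine this.trans ?_
  rw [one_div, ENNReal.rpow_inv_le_iff hq0]
  exact hcost

theorem wasserstein_comm (p : ℝ) (μ ν : Measure (E d)) :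
    wasserstein p μ ν = wasserstein p ν μ := by
  have key : ∀ μ ν : Measure (E d),
      (⨅ (γ : Measure (E d × E d)) (_ : γ.fst = μ ∧ γ.snd = ν), ∫⁻ z, edist z.1 z.2 ^ p ∂γ) ≤
      ⨅ (γ : Measure (E d × E d)) (_ : γ.fst = ν ∧ γ.snd = μ), ∫⁻ z, edist z.1 z.2 ^ p ∂γ := by
    intro μ ν
    refine le_iInf₂ fun γ hγ => ?_
    refine (iInf₂_le (γ.map Prod.swap) ⟨by rw [Measure.fst_map_swap, hγ.2],
      by rw [Measure.snd_map_swap, hγ.1]⟩).trans ?_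
    rw [lintegral_map (by fun_prop) measurable_swap]
    simp [edist_comm]
  unfold wasserstein
  rw [le_antisymm (key μ ν) (key ν μ)]

theorem isTightMeasureSet_of_moment_le {p : ℝ} (hp : 0 < p) {B : ℝ≥0∞} (hB : B ≠ ⊤) :
    IsTightMeasureSet {μ : Measure (E d) | moment p μ ≤ B} := by
  rw [isTightMeasureSet_iff_exists_isCompact_measure_compl_le]
  intro ε hε
  obtain ⟨r, hr⟩ : ∃ r : ℝ, 0 < r ∧ B / ENNReal.ofReal r ^ p ≤ ε := by
    have h1 : Tendsto (fun r : ℝ => B / ENNReal.ofReal r ^ p) atTop (𝓝 (B / ⊤)) :=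
      ENNReal.Tendsto.const_div (((ENNReal.continuous_rpow_const (y := p)).tendsto ⊤).comp
        ENNReal.tendsto_ofReal_atTop |>.congr' (by rfl) |>.trans
          (by rw [ENNReal.top_rpow_of_pos hp])) (.inr hB)
    rw [ENNReal.div_top] at h1
    exact ((eventually_gt_atTop 0).and (ENNReal.tendsto_nhds_zero.1 h1 ε hε)).exists
  refine ⟨Metric.closedBall 0 r, isCompact_closedBall _ _, fun μ hμ => ?_⟩
  have hr0 : ENNReal.ofReal r ^ p ≠ 0 := by simp [hr.1]
  have hrt : ENNReal.ofReal r ^ p ≠ ⊤ := by simp [hp.le]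
  refine le_trans ?_ hr.2
  rw [ENNReal.le_div_iff_mul_le (.inl hr0) (.inl hrt), mul_comm]
  calc ENNReal.ofReal r ^ p * μ (Metric.closedBall 0 r)ᶜ
      ≤ ENNReal.ofReal r ^ p * μ {x | ENNReal.ofReal r ^ p ≤ ‖x‖ₑ ^ p} := by
        gcongr
        intro x hx
        have : r < ‖x‖ := by simpa using hx
        change ENNReal.ofReal r ^ p ≤ ‖x‖ₑ ^ p
        rw [← ofReal_norm]
        gcongr
    _ ≤ moment p μ := mul_meas_ge_le_lintegral (by fun_prop) _
    _ ≤ B := hμ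

theorem moment_le_of_tendsto {p : ℝ} (hp : 0 ≤ p) {u : ℕ → ProbabilityMeasure (E d)}
    {μ : ProbabilityMeasure (E d)} (h : Tendsto u atTop (𝓝 μ)) {B : ℝ≥0∞}
    (hu : ∀ n, moment p (u n : Measure (E d)) ≤ B) : moment p (μ : Measure (E d)) ≤ B := by
  have hm : ∀ κ : Measure (E d), moment p κ = ∫⁻ x, ENNReal.ofReal (‖x‖ ^ p) ∂κ := fun κ => by
    refine lintegral_congr fun x => ?_
    rw [← ofReal_norm, ENNReal.ofReal_rpow_of_nonneg (norm_nonneg _) hp]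
  have hl := lintegral_le_liminf_lintegral_of_forall_isOpen_measure_le_liminf_measure
    (μ := (μ : Measure (E d))) (μs := fun n => (u n : Measure (E d)))
    (f := fun x : E d => ‖x‖ ^ p) (continuous_norm.rpow_const fun _ => .inr hp)
    (fun x => Real.rpow_nonneg (norm_nonneg x) p)
    (fun G hG => ProbabilityMeasure.le_liminf_measure_open_of_tendsto h hG)
  rw [hm]
  refine hl.trans (liminf_le_of_le (by isBoundedDefault) fun b hb => ?_)
  obtain ⟨n, hn⟩ := hb.exists
  exact hn.trans (by rw [← hm]; exact hu n)

theorem moment_lt_top_of_le {q p : ℝ} (hq : 0 < q) (hqp : q < p) {μ : Measure (E d)}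
    [IsProbabilityMeasure μ] (h : moment p μ < ⊤) : moment q μ < ⊤ := by
  obtain ⟨δ, C, -, -, hC, hz⟩ := exists_rpow_le_of_lt hq hqp one_ne_zero ENNReal.one_ne_top
  refine lt_of_le_of_lt (lintegral_mono (g := fun x : E d => 1 + C + 1 * ‖x‖ₑ ^ p) fun x =>
    (hz ‖x‖ₑ).trans ?_) ?_
  · have := indicator_le_self' (s := Ici δ) (f := fun _ : ℝ≥0∞ => C) (fun _ _ => bot_le) ‖x‖ₑ
    dsimp only at this ⊢
    gcongr
  · rw [lintegral_add_left measurable_const, lintegral_const, measure_univ]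
    simp only [one_mul, mul_one]
    exact ENNReal.add_lt_top.2 ⟨ENNReal.add_lt_top.2 ⟨ENNReal.one_lt_top, hC.lt_top⟩, h⟩

/-- Sets of probability measures with bounded moments of order `p` are relatively compact in the
Wasserstein spaces of order `q < p`. -/
theorem isRelCompactWasserstein_of_moment_le {q p : ℝ} (hq : 1 ≤ q) (hqp : q < p) {B : ℝ≥0∞}
    (hB : B ≠ ⊤) {A : Set (Measure (E d))}
    (hA : ∀ μ ∈ A, IsProbabilityMeasure μ ∧ moment p μ ≤ B) : IsRelCompactWasserstein q A := by
  have hq0 : 0 < q := one_pos.trans_le hq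
  refine ⟨fun μ hμ => ?_, fun u hu => ?_⟩
  · obtain ⟨h1, h2⟩ := hA μ hμ
    exact ⟨h1, moment_lt_top_of_le hq0 hqp (h2.trans_lt hB.lt_top)⟩
  · let w : ℕ → ProbabilityMeasure (E d) := fun n => ⟨u n, (hA _ (hu n)).1⟩
    have hw : ∀ n, moment p (w n : Measure (E d)) ≤ B := fun n => (hA _ (hu n)).2
    have htight : IsTightMeasureSet {((μ : ProbabilityMeasure (E d)) : Measure (E d)) |
        μ ∈ range w} := by
      refine (isTightMeasureSet_of_moment_le (hq0.trans hqp) hB).subset ?_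
      rintro _ ⟨μ, ⟨n, rfl⟩, rfl⟩
      exact hw n
    -- Prokhorov's theorem; the moment bound passes to the weak limit by lower semicontinuity.
    obtain ⟨μ, -, k, hk, hlim⟩ := (isCompact_closure_of_isTightMeasureSet htight).tendsto_subseq
      (x := w) fun n => subset_closure (mem_range_self n)
    have hμ := moment_le_of_tendsto (hq0.trans hqp).le hlim fun n => hw (k n)
    refine ⟨μ, inferInstance, moment_lt_top_of_le hq0 hqp (hμ.trans_lt hB.lt_top), k, hk, ?_⟩
    exact tendsto_wasserstein hq hqp hB (.of_forall fun n => hw (k n)) hμ fun δ η hδ _ hη =>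
      eventually_exists_coupling_of_tendsto hlim hδ hη

end Criterion

/-! ### Continuity of the flow in `W_q`. -/

namespace IsSlicedWassersteinFlow

variable {ν : Measure (E d)} {ρ : ℝ → Measure (E d)}

theorem tendsto_wasserstein_two (hρ : IsSlicedWassersteinFlow ν ρ) {t : ℝ} (ht : 0 ≤ t) :
    Tendsto (fun s => wasserstein 2 (ρ s) (ρ t)) (𝓝[Ici 0] t) (𝓝 0) := by
  obtain ⟨g, hg0, hgi, hg⟩ := hρ.acCurve
  have hii : ∀ {s : ℝ}, 0 ≤ s → IntervalIntegrable g volume 0 s := fun {s} hs => by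
    rw [intervalIntegrable_iff_integrableOn_Icc_of_le hs]; exact hgi s
  set F : ℝ → ℝ := fun s => ∫ r in (0 : ℝ)..s, g r with hF
  have hle : ∀ s, 0 ≤ s → wasserstein 2 (ρ s) (ρ t) ≤ ENNReal.ofReal |F s - F t| := by
    have hsub : ∀ {a b : ℝ}, 0 ≤ a → 0 ≤ b → ∫ r in a..b, g r = F b - F a := fun ha hb =>
      (intervalIntegral.integral_interval_sub_left (hii hb) (hii ha)).symm
    intro s hs
    rcases le_total s t with hst | hst
    · refine (hg s t hs hst).trans (ENNReal.ofReal_le_ofReal ?_)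
      rw [hsub hs ht, abs_sub_comm]
      exact le_abs_self _
    · rw [wasserstein_comm]
      refine (hg t s ht hst).trans (ENNReal.ofReal_le_ofReal ?_)
      rw [hsub ht hs]
      exact le_abs_self _
  have hcont : ContinuousWithinAt F (Ici 0) t := by
    have h1 : ContinuousOn F (Icc 0 (t + 1)) := by
      have := intervalIntegral.continuousOn_primitive_interval' (hii (by linarith : 0 ≤ t + 1))
        left_mem_uIcc
      rwa [uIcc_of_le (by linarith)] at this
    refine (h1 t ⟨ht, by linarith⟩).mono_of_mem_nhdsWithin ?_
    rw [← Ici_inter_Iic]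
    exact inter_mem_nhdsWithin _ (Iic_mem_nhds (by linarith))
  have hlim : Tendsto (fun s => ENNReal.ofReal |F s - F t|) (𝓝[Ici 0] t) (𝓝 0) := by
    have h1 : Tendsto (fun s => |F s - F t|) (𝓝[Ici 0] t) (𝓝 |F t - F t|) :=
      (hcont.tendsto.sub tendsto_const_nhds).abs
    rw [sub_self, abs_zero] at h1
    simpa using ENNReal.tendsto_ofReal h1
  refine tendsto_of_tendsto_of_tendsto_of_le_of_le' tendsto_const_nhds hlim
    (.of_forall fun _ => bot_le) ?_
  filter_upwards [self_mem_nhdsWithin] with s hs using hle s hs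

theorem tendsto_wasserstein_of_moment_le (hρ : IsSlicedWassersteinFlow ν ρ) {q p : ℝ}
    (hq : 1 ≤ q) (hqp : q < p) {B : ℝ≥0∞} (hB : B ≠ ⊤) (hm : ∀ t, 0 ≤ t → moment p (ρ t) ≤ B)
    {t : ℝ} (ht : 0 ≤ t) :
    Tendsto (fun s => wasserstein q (ρ s) (ρ t)) (𝓝[Ici 0] t) (𝓝 0) := by
  have := hρ.isProb t ht
  refine tendsto_wasserstein hq hqp hB ?_ (hm t ht) fun δ η hδ hδt hη => ?_
  · filter_upwards [self_mem_nhdsWithin] with s hs using hm s hs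
  · have hδ2 : δ ^ (2 : ℝ) ≠ 0 := by simp [hδ]
    have hδ2t : δ ^ (2 : ℝ) ≠ ⊤ := by simp [hδt]
    -- With `W_2` below this threshold some plan has quadratic cost less than `δ² η`, and
    -- Chebyshev's inequality bounds the mass at distance at least `δ` by `η`.
    have hb : 0 < (δ ^ (2 : ℝ) * η) ^ (2 : ℝ)⁻¹ := by
      rw [pos_iff_ne_zero]
      simp [hδ, hη]
    filter_upwards [(hρ.tendsto_wasserstein_two ht).eventually (gt_mem_nhds hb)] with s hs
    obtain ⟨γ, g1, g2, g3⟩ := exists_plan_of_wasserstein_lt two_pos hs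
    refine ⟨γ, g1, g2, ?_⟩
    rw [ENNReal.rpow_inv_rpow two_ne_zero] at g3
    have hM : δ ^ (2 : ℝ) * γ {z | δ ≤ edist z.1 z.2} ≤ δ ^ (2 : ℝ) * η := by
      refine le_trans ?_ g3.le
      refine le_trans ?_ (mul_meas_ge_le_lintegral (by fun_prop) (δ ^ (2 : ℝ)))
      exact mul_le_mul_right (measure_mono fun z hz => ENNReal.rpow_le_rpow hz two_pos.le) _
    exact (ENNReal.mul_le_mul_iff_right hδ2 hδ2t).1 hM

end IsSlicedWassersteinFlow

end

end SWF

end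

theorem mainTheorem4 (d : ℕ) [NeZero d] (ν : Measure (SWF.E d)) (ρ : ℝ → Measure (SWF.E d))
    (hρ : SWF.IsSlicedWassersteinFlow ν ρ) :
    (∀ p : ℝ, 2 ≤ p →
      (∀ x : SWF.E d,
        ⨍ θ : SWF.S d, |inner ℝ x (θ : SWF.E d)| ^ p ∂(SWF.surf d)
          = SWF.sphereConst d p * ‖x‖ ^ p) ∧
      ∀ t : ℝ, 0 ≤ t →
        SWF.moment p (ρ t) ≤ max (SWF.moment p (ρ 0))
          (ENNReal.ofReal ((d : ℝ) ^ (p / 2) * SWF.sphereConst d p) * SWF.moment p ν)) ∧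
    (∀ t : ℝ, 0 ≤ t →
      SWF.supportRadius (ρ t) ≤ max (SWF.supportRadius (ρ 0))
        (ENNReal.ofReal (Real.sqrt d) * SWF.supportRadius ν)) ∧
    (∀ p : ℝ, 2 ≤ p → SWF.moment p (ρ 0) < ⊤ → SWF.moment p ν < ⊤ →
      ∀ q : ℝ, 1 ≤ q → q < p →
        (∀ t : ℝ, 0 ≤ t →
          Tendsto (fun s => SWF.wasserstein q (ρ s) (ρ t)) (𝓝[Ici 0] t) (𝓝 0)) ∧
        SWF.IsRelCompactWasserstein q (ρ '' Ici 0)) := by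
  refine ⟨fun p hp => ⟨fun x => SWF.integral_abs_inner_rpow p x, fun t ht => hρ.moment_le hp ht⟩,
    fun t ht => hρ.supportRadius_le ht, fun p hp h0 hν q hq hqp => ?_⟩
  have hB : max (SWF.moment p (ρ 0))
      (ENNReal.ofReal ((d : ℝ) ^ (p / 2) * SWF.sphereConst d p) * SWF.moment p ν) ≠ ⊤ :=
    (max_lt h0 (ENNReal.mul_lt_top ENNReal.ofReal_lt_top hν)).ne
  refine ⟨fun t ht => hρ.tendsto_wasserstein_of_moment_le hq hqp hB
    (fun s hs => hρ.moment_le hp hs) ht,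
    SWF.isRelCompactWasserstein_of_moment_le (p := p) hq hqp hB ?_⟩
  rintro _ ⟨t, ht, rfl⟩
  exact ⟨hρ.isProb t ht, hρ.moment_le hp ht⟩
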